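/- Let $\lambda_1,\lambda_2,L,t_f>0$ and $X=\mathbb R\times L^1(0,L)\times L^1(0,L)$ with $\|(p_0,p_1,p_2)\|_X=|p_0|+\|p_1\|_{L^1}+\|p_2\|_{L^1}$. For repair rates $\mu_1,\mu_2$ consider the repairable system $$\dot p_0=-(\lambda_1+\lambda_2)p_0+\sum_{i=1}^2\int_0^L\mu_i p_i\,dx,\qquad \partial_tp_1+\partial_xp_1=-(\mu_1+\lambda_2)p_1,\qquad \partial_tp_2+\partial_xp_2=-\mu_2p_2,$$ $$p_1(0,t)=\lambda_1p_0(t),\qquad p_2(0,t)=\lambda_2p_0(t)+\lambda_2\int_0^Lp_1(x,t)\,dx,$$ i.e. $\dot{\vec p}=\mathcal A\vec p$, where $D(\mathcal A)$ consists of the states with $p_i\in W^{1,1}(0,L)$, $\mu_ip_i\in L^1(0,L)$ and these boundary conditions. Let $\vec p(0)=\vec\phi=(\phi_0,\phi_1,\phi_2)\in X$ with $\phi_0,\phi_1,\phi_2\ge0$ and $\|\vec\phi\|_X=1$. Let $\vec p^*=(p_0^*,p_1^*,p_2^*)\in\mathbb R\times W^{1,1}(0,L)\times W^{1,1}(0,L)$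 satisfy $$p_1^*(0)=\lambda_1p_0^*,\quad p_2^*(0)=\lambda_2p_0^*+\lambda_2\int_0^Lp_1^*\,dx,\quad p_i^*(L)=0,\quad p_0^*=1-\sum_{i=1}^2\int_0^Lp_i^*\,dx,\quad p_i^*\ge0\ (i=1,2),$$ and, for some $\epsilon>0$, $(p_1^*)'\le-\epsilon$ and $(p_2^*)'<0$ a.e. on $(0,L)$. Put $g_i=1/p_i^*$, $r_0=6t_f/\pi^2$, $t_j=r_0\sum_{k=1}^jk^{-2}$ (so $t_0=0$ and $t_j\uparrow t_f$), let $\alpha_1,\alpha_2>0$, and consider, for $t\in[t_{j-1},t_j)$, $j\ge1$, the feedback rates $$\mu_1=-\frac{\partial_xp_1}{p_1}+\alpha_1j\,\frac{\partial_x(g_1p_1)}{p_1}-\lambda_2,\qquad \mu_2=-\frac{\partial_xp_2}{p_2}+\alpha_2j\,\frac{\partial_x(g_2p_2)}{p_2},$$ where quotients are read as $0$ at zeros of $p_i$. (No sign of these rates is asserted.) Let $\mathcal A_j$ be the operator of the system under these rates, that is, $\mathcal A_j\vec q=\mathcal A\vec q$ with the rates of weight $j$ computed from $\vec q$, for those $\vec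 q$ that lie in the resulting $D(\mathcal A)$. Then the system under these feedback rates has a unique mild solution $\vec p\in C([0,t_f);X)$ with $\vec p(0)=\vec\phi$, i.e. $\vec p(t)-\vec p(t_{j-1})=\mathcal A_j\int_{t_{j-1}}^t\vec p(s)\,ds$ for $t\in[t_{j-1},t_j]$, $j\ge1$. If $\vec\phi\in D(\mathcal A_1)$, it is classical: $\dot{\vec p}(t)=\mathcal A_j\vec p(t)$ for $t\in[t_{j-1},t_j)$ and all $j\ge1$ (right derivative at $t_{j-1}$). Finally, $\vec p$ extends continuously in $X$ to $[0,t_f]$, and $\vec p(t_f)=\vec p^*$. -/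

import Mathlib

open MeasureTheory Set

noncomputable section

/-- Lebesgue measure on the interval `(0, L)` (the right endpoint is a null set). -/
abbrev ageMeasure (L : ℝ) : Measure ℝ := volume.restrict (Ioc 0 L)

/-- The state space `X = ℝ × L¹(0,L) × L¹(0,L)`. Its topology is the one of the norm `stateNorm`. -/
abbrev RepairState (L : ℝ) : Type :=
  ℝ × Lp ℝ 1 (ageMeasure L) × Lp ℝ 1 (ageMeasure L)

/-- The norm `|p₀| + ‖p₁‖_{L¹} + ‖p₂‖_{L¹}` of `X`. -/
def stateNorm {L : ℝ} (p : RepairState L) : ℝ := |p.1| + ‖p.2.1‖ + ‖p.2.2‖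

/-- `SystemOperator lam1 lam2 L mu1 mu2 p₀ P₁ P₂ v` says that the state `(p₀, P₁, P₂)` lies in the
domain of the system operator `𝒜` with repair rates `mu1`, `mu2`, and that `𝒜 (p₀, P₁, P₂) = v`.
Here `P₁`, `P₂` are the absolutely continuous representatives of elements of `W^{1,1}(0,L)`; their
weak derivatives are the almost everywhere derivatives `deriv P₁`, `deriv P₂`. -/
structure SystemOperator (lam1 lam2 L : ℝ) (mu1 mu2 : ℝ → ℝ) (p₀ : ℝ) (P₁ P₂ : ℝ → ℝ)
    (v : RepairState L) : Prop where
  ac₁ : AbsolutelyContinuousOnInterval P₁ 0 L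
  ac₂ : AbsolutelyContinuousOnInterval P₂ 0 L
  integrable₁ : Integrable (fun x => mu1 x * P₁ x) (ageMeasure L)
  integrable₂ : Integrable (fun x => mu2 x * P₂ x) (ageMeasure L)
  boundary₁ : P₁ 0 = lam1 * p₀
  boundary₂ : P₂ 0 = lam2 * p₀ + lam2 * ∫ x in (0 : ℝ)..L, P₁ x
  eq₀ : v.1 = -(lam1 + lam2) * p₀ + ((∫ x in (0 : ℝ)..L, mu1 x * P₁ x)
    + ∫ x in (0 : ℝ)..L, mu2 x * P₂ x)
  eq₁ : ∀ᵐ x ∂(ageMeasure L), v.2.1 x = -(deriv P₁ x + (mu1 x + lam2) * P₁ x)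
  eq₂ : ∀ᵐ x ∂(ageMeasure L), v.2.2 x = -(deriv P₂ x + mu2 x * P₂ x)

/-- The feedback rate `-P'/P + α w (g P)'/P - c` with `g = 1/pstar` and weight `w`. At points where
`P` vanishes the value is `-c`; the rate only enters the system through its product with `P`, and
`P'` and `(g P)'` vanish almost everywhere on the zero set of `P`. -/
def feedbackRate (α w c : ℝ) (pstar P : ℝ → ℝ) (x : ℝ) : ℝ :=
  -(1 / P x * deriv P x) + α * w * (1 / P x * deriv (fun y => 1 / pstar y * P y) x) - c

/-- `ClosedLoop … w p v`: the state `p` lies in the domain of the system operator whose repair rates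
are the feedback rates (with weight `w`) computed from `p`, and that operator maps `p` to `v`. -/
def ClosedLoop (lam1 lam2 L : ℝ) (ps₁ ps₂ : ℝ → ℝ) (α₁ α₂ w : ℝ) (p v : RepairState L) : Prop :=
  ∃ P₁ P₂ : ℝ → ℝ, p.2.1 =ᵐ[ageMeasure L] P₁ ∧ p.2.2 =ᵐ[ageMeasure L] P₂ ∧
    SystemOperator lam1 lam2 L (feedbackRate α₁ w lam2 ps₁ P₁) (feedbackRate α₂ w 0 ps₂ P₂)
      p.1 P₁ P₂ v

/-- The switching times `t_j = r₀ ∑_{k=1}^{j} 1/k²` with `r₀ = 6 t_f / π²`, so that `t_j ↑ t_f`. -/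
def switchTime (tf : ℝ) (j : ℕ) : ℝ :=
  6 * tf / Real.pi ^ 2 * ∑ k ∈ Finset.Icc 1 j, 1 / (k : ℝ) ^ 2

/-- Mild solutions on `[0, t_f)` with initial state `φ`: continuous functions `p` with `p 0 = φ` such
that on each interval `[t_j, t_{j+1}]` one has `p t - p t_j = 𝒜_{j+1} ∫_{t_j}^t p`, where `𝒜_{j+1}` is
the operator of the system under the feedback rates with weight `j + 1`. -/
structure IsMildSolution (lam1 lam2 L : ℝ) (ps₁ ps₂ : ℝ → ℝ) (α₁ α₂ tf : ℝ) (φ : RepairState L)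
    (p : ℝ → RepairState L) : Prop where
  continuousOn : ContinuousOn p (Ico 0 tf)
  initial : p 0 = φ
  mild : ∀ j : ℕ, ∀ t ∈ Icc (switchTime tf j) (switchTime tf (j + 1)),
    ClosedLoop lam1 lam2 L ps₁ ps₂ α₁ α₂ (j + 1)
      (∫ s in (switchTime tf j)..t, p s) (p t - p (switchTime tf j))

/-- The differential equation of the system holds in `X` at every time of `[0, t_f)`, with the
feedback rates of weight `j + 1` computed from the current state `p t` for `t ∈ [t_j, t_{j+1})`
(the derivative is the right one at `t_j`). -/
def SolvesClassically (lam1 lam2 L : ℝ) (ps₁ ps₂ : ℝ → ℝ) (α₁ α₂ tf : ℝ)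
    (p : ℝ → RepairState L) : Prop :=
  ∀ j : ℕ, ∀ t ∈ Ico (switchTime tf j) (switchTime tf (j + 1)),
    ∃ v : RepairState L, ClosedLoop lam1 lam2 L ps₁ ps₂ α₁ α₂ (j + 1) (p t) v ∧
      HasDerivWithinAt p v (Ico (switchTime tf j) (switchTime tf (j + 1))) t

/-- The conditions on the desired state `(ps₀, ps₁, ps₂) ∈ ℝ × W^{1,1}(0,L) × W^{1,1}(0,L)`. -/
structure IsDesiredState (lam1 lam2 L : ℝ) (ps₀ : ℝ) (ps₁ ps₂ : ℝ → ℝ) : Prop where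
  ac₁ : AbsolutelyContinuousOnInterval ps₁ 0 L
  ac₂ : AbsolutelyContinuousOnInterval ps₂ 0 L
  boundary₁ : ps₁ 0 = lam1 * ps₀
  boundary₂ : ps₂ 0 = lam2 * ps₀ + lam2 * ∫ x in (0 : ℝ)..L, ps₁ x
  vanish₁ : ps₁ L = 0
  vanish₂ : ps₂ L = 0
  total : ps₀ = 1 - ((∫ x in (0 : ℝ)..L, ps₁ x) + ∫ x in (0 : ℝ)..L, ps₂ x)
  nonneg₁ : ∀ x ∈ Icc 0 L, 0 ≤ ps₁ x
  nonneg₂ : ∀ x ∈ Icc 0 L, 0 ≤ ps₂ x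
  deriv₁ : ∃ ε > 0, ∀ᵐ x ∂(ageMeasure L), deriv ps₁ x ≤ -ε
  deriv₂ : ∀ᵐ x ∂(ageMeasure L), deriv ps₂ x < 0

end

/-- At all but countably many zeros of a function its derivative vanishes. -/
theorem countable_setOf_eq_zero_and_deriv_ne_zero (f : ℝ → ℝ) :
    {x | f x = 0 ∧ deriv f x ≠ 0}.Countable := by
  refine (HereditarilyLindelofSpace.isLindelof _).countable_of_isDiscrete ?_
  rw [isDiscrete_iff_nhdsNE]
  rintro x ⟨hx, hd⟩
  rw [← Filter.empty_mem_iff_bot, Filter.mem_inf_principal]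
  have h := (differentiableAt_of_deriv_ne_zero hd).hasDerivAt.eventually_ne (c := 0) hd
  filter_upwards [h] with y hy hy'
  exact hy hy'.1

theorem ae_deriv_eq_zero_of_eq_zero (f : ℝ → ℝ) : ∀ᵐ x : ℝ, f x = 0 → deriv f x = 0 := by
  filter_upwards [(countable_setOf_eq_zero_and_deriv_ne_zero f).ae_notMem volume] with x hx h
  by_contra hd
  exact hx ⟨h, hd⟩

theorem AbsolutelyContinuousOnInterval.of_dist_le_mul {f g : ℝ → ℝ} {a b K : ℝ} (hK : 0 < K)
    (hf : AbsolutelyContinuousOnInterval f a b)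
    (h : ∀ x ∈ uIcc a b, ∀ y ∈ uIcc a b, dist (g x) (g y) ≤ K * dist (f x) (f y)) :
    AbsolutelyContinuousOnInterval g a b := by
  rw [absolutelyContinuousOnInterval_iff] at hf ⊢
  intro ε hε
  obtain ⟨δ, hδ, H⟩ := hf (ε / K) (by positivity)
  refine ⟨δ, hδ, fun E hE hs => ?_⟩
  have h1 := H E hE hs
  rw [lt_div_iff₀' hK, Finset.mul_sum] at h1
  refine lt_of_le_of_lt (Finset.sum_le_sum fun i hi => ?_) h1
  exact h _ (hE.1 i hi).1 _ (hE.1 i hi).2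

theorem AbsolutelyContinuousOnInterval.one_div {f : ℝ → ℝ} {a b δ : ℝ} (hδ : 0 < δ)
    (hf : AbsolutelyContinuousOnInterval f a b) (h : ∀ x ∈ uIcc a b, δ ≤ f x) :
    AbsolutelyContinuousOnInterval (fun x => 1 / f x) a b := by
  refine hf.of_dist_le_mul (K := 1 / δ ^ 2) (by positivity) fun x hx y hy => ?_
  have hx' := h x hx
  have hy' := h y hy
  have hx0 : 0 < f x := by linarith
  have hy0 : 0 < f y := by linarith
  have e : 1 / f x - 1 / f y = (f y - f x) / (f x * f y) := by field_simp
  rw [Real.dist_eq, Real.dist_eq, e, abs_div, abs_sub_comm (f y), abs_of_pos (mul_pos hx0 hy0),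
    div_eq_mul_one_div, mul_comm]
  refine mul_le_mul_of_nonneg_right ?_ (abs_nonneg _)
  refine one_div_le_one_div_of_le (by positivity) ?_
  rw [sq]
  exact mul_le_mul hx' hy' hδ.le hx0.le

theorem AbsolutelyContinuousOnInterval.const (k a b : ℝ) :
    AbsolutelyContinuousOnInterval (fun _ => k) a b := by
  rw [absolutelyContinuousOnInterval_iff]
  intro ε hε
  exact ⟨1, one_pos, fun E _ _ => by simpa using hε⟩

theorem ae_ageMeasure_mem_Ioo (L : ℝ) : ∀ᵐ x ∂(ageMeasure L), x ∈ Ioo 0 L := by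
  have h : ∀ᵐ x ∂(ageMeasure L), x ≠ L :=
    ae_restrict_of_ae (measure_eq_zero_iff_ae_notMem.1 (measure_singleton L))
  filter_upwards [h, ae_restrict_mem measurableSet_Ioc] with x hx hx'
  exact ⟨hx'.1, lt_of_le_of_ne hx'.2 hx⟩

/-- An absolutely continuous function on `[0, L]` that is positive on `[0, L)` and
vanishes at `L`. -/
structure IsProfile (L : ℝ) (f : ℝ → ℝ) : Prop where
  ac : AbsolutelyContinuousOnInterval f 0 L
  pos : ∀ x ∈ Ico 0 L, 0 < f x
  vanish : f L = 0

theorem IsProfile.of_deriv_neg {L : ℝ} {f : ℝ → ℝ} (hL : 0 < L)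
    (hf : AbsolutelyContinuousOnInterval f 0 L)
    (h0 : f L = 0) (hd : ∀ᵐ x ∂(ageMeasure L), deriv f x < 0) : IsProfile L f := by
  refine ⟨hf, fun x hx => ?_, h0⟩
  have hac : AbsolutelyContinuousOnInterval f x L := hf.mono (by
    rw [uIcc_of_le hx.2.le, uIcc_of_le hL.le]; exact Icc_subset_Icc_left hx.1)
  have h1 := hac.integral_deriv_eq_sub
  have h2 : 0 < ∫ y in x..L, -deriv f y := by
    refine (intervalIntegral.integral_pos_iff_support_of_nonneg_ae' ?_
      hac.intervalIntegrable_deriv.neg).2 ⟨hx.2, ?_⟩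
    · rw [uIoc_of_le hx.2.le]
      have := ae_restrict_of_ae_restrict_of_subset (Ioc_subset_Ioc_left hx.1 (b := L)) hd
      filter_upwards [this] with y hy
      simpa using hy.le
    · have hsub := ae_restrict_of_ae_restrict_of_subset (Ioc_subset_Ioc_left hx.1 (b := L)) hd
      have h3 : volume (Function.support (-deriv f) ∩ Ioc x L) = volume (Ioc x L) := by
        apply measure_congr
        have := (ae_restrict_iff' measurableSet_Ioc).1 hsub
        filter_upwards [this] with y hy
        apply propext
        constructor
        · exact fun h => h.2
        · exact fun h => ⟨by simpa using (hy h).ne, h⟩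
      rw [h3, Real.volume_Ioc]
      simpa using hx.2
  rw [intervalIntegral.integral_neg, h1, h0] at h2
  linarith

noncomputable section

/-- The space `L¹(0, L)`. -/
abbrev AgeL1 (L : ℝ) : Type := Lp ℝ 1 (ageMeasure L)

theorem AgeL1.integrable {L : ℝ} (v : AgeL1 L) : Integrable v (ageMeasure L) :=
  L1.integrable_coeFn v

theorem AgeL1.norm_eq {L : ℝ} (v : AgeL1 L) : ‖v‖ = ∫ x, ‖v x‖ ∂(ageMeasure L) :=
  L1.norm_eq_integral_norm v

theorem AgeL1.intervalIntegrable {L : ℝ} (v : AgeL1 L) {x y : ℝ} (hx : x ∈ Icc 0 L)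
    (hy : y ∈ Icc 0 L) : IntervalIntegrable v volume x y := by
  have h : IntegrableOn v (Ioc 0 L) := v.integrable
  rw [intervalIntegrable_iff]
  refine h.mono_set fun z hz => ?_
  rw [mem_uIoc] at hz
  rcases hz with hz | hz
  · exact ⟨hx.1.trans_lt hz.1, hz.2.trans hy.2⟩
  · exact ⟨hy.1.trans_lt hz.1, hz.2.trans hx.2⟩

theorem integral_ageMeasure {L : ℝ} (hL : 0 ≤ L) (f : ℝ → ℝ) :
    ∫ x, f x ∂(ageMeasure L) = ∫ x in (0 : ℝ)..L, f x := by
  rw [intervalIntegral.integral_of_le hL]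

/-- The primitive `x ↦ ∫₀ˣ v` of `v ∈ L¹(0, L)`, as a functional of `v`. -/
def primitive (L x : ℝ) : AgeL1 L →L[ℝ] ℝ :=
  LinearMap.mkContinuous
    { toFun := fun v => ∫ y in Iic x, v y ∂(ageMeasure L)
      map_add' := fun u v => by
        rw [← integral_add u.integrable.integrableOn v.integrable.integrableOn]
        exact integral_congr_ae (ae_restrict_of_ae (Lp.coeFn_add u v))
      map_smul' := fun k v => by
        rw [RingHom.id_apply, smul_eq_mul, ← integral_const_mul]
        exact integral_congr_ae (ae_restrict_of_ae (Lp.coeFn_smul k v)) } 1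
    fun v => by
      rw [one_mul, v.norm_eq]
      refine (norm_integral_le_integral_norm _).trans ?_
      exact setIntegral_le_integral v.integrable.norm (Filter.Eventually.of_forall fun _ => norm_nonneg _)

theorem primitive_apply (L x : ℝ) (v : AgeL1 L) :
    primitive L x v = ∫ y in Iic x, v y ∂(ageMeasure L) := rfl

theorem abs_primitive_le (L x : ℝ) (v : AgeL1 L) : |primitive L x v| ≤ ‖v‖ := by
  rw [primitive_apply, v.norm_eq, ← Real.norm_eq_abs]
  refine (norm_integral_le_integral_norm _).trans ?_
  exact setIntegral_le_integral v.integrable.norm (Filter.Eventually.of_forall fun _ => norm_nonneg _)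

theorem primitive_eq {L x : ℝ} (hx : x ∈ Icc 0 L) (v : AgeL1 L) :
    primitive L x v = ∫ y in (0 : ℝ)..x, v y := by
  rw [primitive_apply, Measure.restrict_restrict measurableSet_Iic,
    intervalIntegral.integral_of_le hx.1, inter_comm, Ioc_inter_Iic, min_eq_right hx.2]

theorem continuousOn_primitive (L : ℝ) (v : AgeL1 L) :
    ContinuousOn (fun x => primitive L x v) (Icc 0 L) := by
  by_cases hL : 0 ≤ L
  · have h := intervalIntegral.continuousOn_primitive_interval (μ := volume) (f := v) (a := 0) (b := L)
      (by rw [uIcc_of_le hL, integrableOn_Icc_iff_integrableOn_Ioc]; exact v.integrable)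
    rw [uIcc_of_le hL] at h
    exact h.congr fun x hx => primitive_eq hx v
  · rw [Icc_eq_empty hL]; exact continuousOn_empty _

theorem aestronglyMeasurable_primitive (L : ℝ) (v : AgeL1 L) :
    AEStronglyMeasurable (fun x => primitive L x v) (ageMeasure L) :=
  ((continuousOn_primitive L v).mono Ioc_subset_Icc_self).aestronglyMeasurable measurableSet_Ioc

theorem integrable_mul_primitive {L : ℝ} (e v : AgeL1 L) :
    Integrable (fun x => e x * primitive L x v) (ageMeasure L) :=
  e.integrable.mul_bdd (c := ‖v‖) (aestronglyMeasurable_primitive L v)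
    (Filter.Eventually.of_forall fun x => abs_primitive_le L x v)

theorem norm_toL1_mul_primitive_le {L : ℝ} (e v : AgeL1 L) :
    ‖(integrable_mul_primitive e v).toL1 _‖ ≤ ‖e‖ * ‖v‖ := by
  rw [L1.norm_of_fun_eq_integral_norm, e.norm_eq, ← integral_mul_const]
  refine integral_mono (integrable_mul_primitive e v).norm (e.integrable.norm.mul_const _) fun x => ?_
  rw [norm_mul]
  exact mul_le_mul_of_nonneg_left (abs_primitive_le L x v) (norm_nonneg _)

/-- The operator `v ↦ e · ∫₀ˣ v` on `L¹(0, L)`. -/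
def volterra {L : ℝ} (e : AgeL1 L) : AgeL1 L →L[ℝ] AgeL1 L :=
  LinearMap.mkContinuous
    { toFun := fun v => (integrable_mul_primitive e v).toL1 _
      map_add' := fun u v => by
        rw [← Integrable.toL1_add, Integrable.toL1_eq_toL1_iff]
        refine Filter.Eventually.of_forall fun x => ?_
        simp only [map_add, Pi.add_apply, mul_add]
      map_smul' := fun k v => by
        rw [RingHom.id_apply, ← Integrable.toL1_smul, Integrable.toL1_eq_toL1_iff]
        refine Filter.Eventually.of_forall fun x => ?_
        simp only [map_smul, smul_eq_mul]
        ring } ‖e‖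
    fun v => norm_toL1_mul_primitive_le e v

theorem coeFn_volterra {L : ℝ} (e v : AgeL1 L) :
    volterra e v =ᵐ[ageMeasure L] fun x => e x * primitive L x v :=
  (integrable_mul_primitive e v).coeFn_toL1

/-- Two functions in `L¹(0, L)` with the same primitive agree. -/
theorem AgeL1.ext_primitive {L : ℝ} (hL : 0 ≤ L) {u v : AgeL1 L}
    (h : ∀ x ∈ Icc 0 L, primitive L x u = primitive L x v) : u = v := by
  rw [← sub_eq_zero]
  set w := u - v with hw
  have h0 : ∀ x ∈ Icc 0 L, ∫ y in (0 : ℝ)..x, w y = 0 := fun x hx => by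
    rw [← primitive_eq hx, hw, map_sub, h x hx, sub_self]
  have hi := w.intervalIntegrable (left_mem_Icc.2 hL) (right_mem_Icc.2 hL)
  rw [Lp.eq_zero_iff_ae_eq_zero]
  have hd := ae_restrict_of_ae (s := Ioc 0 L) hi.ae_hasDerivAt_integral
  filter_upwards [hd, ae_ageMeasure_mem_Ioo L] with x hx hx'
  rw [uIcc_of_le hL] at hx
  have h1 := hx ⟨hx'.1.le, hx'.2.le⟩ 0 (left_mem_Icc.2 hL)
  have h2 : HasDerivAt (fun x => ∫ y in (0 : ℝ)..x, w y) 0 x := by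
    refine (hasDerivAt_const x (0 : ℝ)).congr_of_eventuallyEq ?_
    filter_upwards [Ioo_mem_nhds hx'.1 hx'.2] with y hy
    exact h0 y ⟨hy.1.le, hy.2.le⟩
  exact h1.unique h2

/-- The linear map whose kernel is the graph of the closed-loop operator:
`p₁ = (p₀ / a) e₁ - c₁⁻¹ e₁ ∫₀ˣ v₁`, `p₂ = ((p₀ + ∫ p₁) / A) e₂ - c₂⁻¹ e₂ ∫₀ˣ v₂` and
`v₀ + ∫ v₁ + ∫ v₂ = 0`. -/
def graphMap {L : ℝ} (a A c₁ c₂ : ℝ) (e₁ e₂ : AgeL1 L) :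
    RepairState L × RepairState L →L[ℝ] ℝ × AgeL1 L × AgeL1 L :=
  let p₀ : RepairState L →L[ℝ] ℝ := ContinuousLinearMap.fst ℝ _ _
  let p₁ : RepairState L →L[ℝ] AgeL1 L :=
    (ContinuousLinearMap.fst ℝ _ _).comp (ContinuousLinearMap.snd ℝ _ _)
  let p₂ : RepairState L →L[ℝ] AgeL1 L :=
    (ContinuousLinearMap.snd ℝ _ _).comp (ContinuousLinearMap.snd ℝ _ _)
  let p : RepairState L × RepairState L →L[ℝ] RepairState L := ContinuousLinearMap.fst ℝ _ _
  let v : RepairState L × RepairState L →L[ℝ] RepairState L := ContinuousLinearMap.snd ℝ _ _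
  ((p₀ + (primitive L L).comp p₁ + (primitive L L).comp p₂).comp v).prod
    ((p₁.comp p - (a⁻¹ • p₀.comp p).smulRight e₁ + c₁⁻¹ • (volterra e₁).comp (p₁.comp v)).prod
      (p₂.comp p - (A⁻¹ • (p₀ + (primitive L L).comp p₁).comp p).smulRight e₂
        + c₂⁻¹ • (volterra e₂).comp (p₂.comp v)))

theorem graphMap_eq_zero_iff {L : ℝ} (a A c₁ c₂ : ℝ) (e₁ e₂ : AgeL1 L) (p v : RepairState L) :
    graphMap a A c₁ c₂ e₁ e₂ (p, v) = 0 ↔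
      v.1 + primitive L L v.2.1 + primitive L L v.2.2 = 0 ∧
      p.2.1 = (a⁻¹ * p.1) • e₁ - c₁⁻¹ • volterra e₁ v.2.1 ∧
      p.2.2 = (A⁻¹ * (p.1 + primitive L L p.2.1)) • e₂ - c₂⁻¹ • volterra e₂ v.2.2 := by
  have h : graphMap a A c₁ c₂ e₁ e₂ (p, v) = (v.1 + primitive L L v.2.1 + primitive L L v.2.2,
      p.2.1 - (a⁻¹ * p.1) • e₁ + c₁⁻¹ • volterra e₁ v.2.1,
      p.2.2 - (A⁻¹ * (p.1 + primitive L L p.2.1)) • e₂ + c₂⁻¹ • volterra e₂ v.2.2) := rfl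
  rw [h, Prod.mk_eq_zero, Prod.mk_eq_zero, sub_add, sub_eq_zero, sub_add, sub_eq_zero]

theorem IsProfile.one_div_ac {L y : ℝ} {f : ℝ → ℝ} (hf : IsProfile L f) (hy : y ∈ Ico 0 L) :
    AbsolutelyContinuousOnInterval (fun x => 1 / f x) 0 y := by
  have hac : AbsolutelyContinuousOnInterval f 0 y := hf.ac.mono (by
    rw [uIcc_of_le hy.1, uIcc_of_le (hy.1.trans hy.2.le)]; exact Icc_subset_Icc_right hy.2.le)
  obtain ⟨z, hz, hmin⟩ := isCompact_uIcc.exists_isMinOn ⟨0, left_mem_uIcc⟩ hac.continuousOn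
  rw [uIcc_of_le hy.1] at hz
  exact hac.one_div (hf.pos z ⟨hz.1, hz.2.trans_lt hy.2⟩) fun x hx => hmin hx

/-- Under the feedback, `∂ₓ P + (μ + c) P = α w ∂ₓ (P / f)` almost everywhere. -/
theorem feedbackRate_mul_ae (L α w c : ℝ) (f P : ℝ → ℝ) :
    ∀ᵐ x ∂(ageMeasure L), deriv P x + (feedbackRate α w c f P x + c) * P x =
      α * w * deriv (fun y => 1 / f y * P y) x := by
  filter_upwards [ae_restrict_of_ae (ae_deriv_eq_zero_of_eq_zero P),
    ae_restrict_of_ae (ae_deriv_eq_zero_of_eq_zero fun y => 1 / f y * P y)] with x h1 h2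
  by_cases hP : P x = 0
  · rw [h1 hP, h2 (by rw [hP, mul_zero]), hP]
    ring
  · rw [feedbackRate]
    field_simp
    ring

theorem IsProfile.eq_of_feedback {L : ℝ} (hL : 0 < L) {f : ℝ → ℝ} (hf : IsProfile L f)
    {α w c : ℝ} (hα : 0 < α) (hw : 0 < w) {P : ℝ → ℝ}
    (hP : AbsolutelyContinuousOnInterval P 0 L) {v : AgeL1 L}
    (hv : ∀ᵐ x ∂(ageMeasure L), v x = -(deriv P x + (feedbackRate α w c f P x + c) * P x)) :
    ∀ x ∈ Icc 0 L, P x = f x * (P 0 / f 0 - (α * w)⁻¹ * primitive L x v) := by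
  have hcont : ContinuousOn (fun x => f x * (P 0 / f 0 - (α * w)⁻¹ * primitive L x v)) (Icc 0 L) := by
    have h1 := hf.ac.continuousOn
    rw [uIcc_of_le hL.le] at h1
    exact h1.mul (continuousOn_const.sub (continuousOn_const.mul (continuousOn_primitive L v)))
  have hcP := hP.continuousOn
  rw [uIcc_of_le hL.le] at hcP
  have hU : ∀ᵐ x ∂(ageMeasure L), deriv (fun y => 1 / f y * P y) x = -(α * w)⁻¹ * v x := by
    filter_upwards [hv, feedbackRate_mul_ae L α w c f P] with x h1 h2
    rw [h1, h2]
    field_simp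
  have key : ∀ x ∈ Ico 0 L, P x = f x * (P 0 / f 0 - (α * w)⁻¹ * primitive L x v) := by
    intro x hx
    have hPx : AbsolutelyContinuousOnInterval P 0 x := hP.mono (by
      rw [uIcc_of_le hx.1, uIcc_of_le hL.le]; exact Icc_subset_Icc_right hx.2.le)
    have h1 := ((hf.one_div_ac hx).fun_mul hPx).integral_deriv_eq_sub
    have h2 : ∫ y in (0 : ℝ)..x, deriv (fun y => 1 / f y * P y) y
        = ∫ y in (0 : ℝ)..x, -(α * w)⁻¹ * v y := by
      refine intervalIntegral.integral_congr_ae ?_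
      filter_upwards [(ae_restrict_iff' measurableSet_Ioc).1 hU] with y hy hy'
      rw [uIoc_of_le hx.1] at hy'
      exact hy ⟨hy'.1, hy'.2.trans hx.2.le⟩
    rw [h2, intervalIntegral.integral_const_mul, ← primitive_eq ⟨hx.1, hx.2.le⟩] at h1
    have hpos := (hf.pos x hx).ne'
    have h3 : P x = f x * (1 / f x * P x) := by field_simp
    have h4 : 1 / f x * P x = P 0 / f 0 - (α * w)⁻¹ * primitive L x v := by
      rw [div_eq_mul_one_div (P 0)]; linarith
    rw [h3, h4]
  intro x hx
  have hcl : Icc 0 L ⊆ closure (Ico 0 L) := by rw [closure_Ico hL.ne]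
  exact (EqOn.of_subset_closure (s := Ico 0 L) key hcP hcont Ico_subset_Icc_self hcl) hx

theorem integral_feedback_mul {L : ℝ} (hL : 0 < L) {P μ : ℝ → ℝ} {c : ℝ}
    (hP : AbsolutelyContinuousOnInterval P 0 L) (hPL : P L = 0) {v : AgeL1 L}
    (hv : ∀ᵐ x ∂(ageMeasure L), v x = -(deriv P x + (μ x + c) * P x)) :
    Integrable (fun x => μ x * P x) (ageMeasure L) ∧
      ∫ x in (0 : ℝ)..L, μ x * P x = P 0 - primitive L L v - c * ∫ x in (0 : ℝ)..L, P x := by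
  have hd := hP.intervalIntegrable_deriv
  have hPi := hP.continuousOn.intervalIntegrable (μ := volume)
  have hvi := v.intervalIntegrable (left_mem_Icc.2 hL.le) (right_mem_Icc.2 hL.le)
  have hn : IntervalIntegrable (fun x => -v x) volume 0 L := hvi.neg
  have hi : IntervalIntegrable (fun x => -v x - deriv P x - c * P x) volume 0 L :=
    (hn.sub hd).sub (hPi.const_mul c)
  have he : (fun x => -v x - deriv P x - c * P x) =ᵐ[ageMeasure L] fun x => μ x * P x := by
    filter_upwards [hv] with x hx
    rw [hx]
    ring
  have hi' := (intervalIntegrable_iff_integrableOn_Ioc_of_le hL.le).1 hi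
  refine ⟨hi'.congr he, ?_⟩
  rw [← integral_ageMeasure hL.le, ← integral_congr_ae he, integral_ageMeasure hL.le,
    intervalIntegral.integral_sub (hn.sub hd) (hPi.const_mul c),
    intervalIntegral.integral_sub hn hd, intervalIntegral.integral_neg,
    intervalIntegral.integral_const_mul, hP.integral_deriv_eq_sub, hPL,
    primitive_eq (right_mem_Icc.2 hL.le)]
  ring

theorem IsProfile.feedback_of_eq {L : ℝ} (hL : 0 < L) {f : ℝ → ℝ} (hf : IsProfile L f)
    {α w : ℝ} (c : ℝ) (hα : 0 < α) (hw : 0 < w) (k : ℝ) (v : AgeL1 L) {P : ℝ → ℝ}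
    (hP : P = fun x => f x * (k - (α * w)⁻¹ * ∫ y in (0 : ℝ)..x, v y)) :
    AbsolutelyContinuousOnInterval P 0 L ∧
    ∀ᵐ x ∂(ageMeasure L), v x = -(deriv P x + (feedbackRate α w c f P x + c) * P x) := by
  have hvi := v.intervalIntegrable (left_mem_Icc.2 hL.le) (right_mem_Icc.2 hL.le)
  have hac := hvi.absolutelyContinuousOnInterval_intervalIntegral (left_mem_uIcc)
  refine ⟨?_, ?_⟩
  · rw [hP]
    exact hf.ac.fun_mul ((AbsolutelyContinuousOnInterval.const k 0 L).fun_sub (hac.const_mul (α * w)⁻¹))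
  · filter_upwards [ae_ageMeasure_mem_Ioo L, feedbackRate_mul_ae L α w c f P,
      ae_restrict_of_ae hvi.ae_hasDerivAt_integral] with x hx h1 h2
    rw [h1]
    rw [uIcc_of_le hL.le] at h2
    have h3 := h2 ⟨hx.1.le, hx.2.le⟩ 0 (left_mem_Icc.2 hL.le)
    have h4 : HasDerivAt (fun y => 1 / f y * P y) (-((α * w)⁻¹ * v x)) x := by
      refine ((h3.const_mul (α * w)⁻¹).const_sub k).congr_of_eventuallyEq ?_
      filter_upwards [Ioo_mem_nhds hx.1 hx.2] with y hy
      have := (hf.pos y ⟨hy.1.le, hy.2⟩).ne'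
      rw [hP]
      field_simp
    rw [h4.deriv]
    field_simp

theorem IsProfile.integrable {L : ℝ} (hL : 0 < L) {f : ℝ → ℝ} (hf : IsProfile L f) :
    Integrable f (ageMeasure L) :=
  (intervalIntegrable_iff_integrableOn_Ioc_of_le hL.le).1
    (hf.ac.continuousOn.intervalIntegrable (μ := volume))

theorem coeFn_smul_sub_smul_volterra {L : ℝ} (e v : AgeL1 L) {f : ℝ → ℝ}
    (he : e =ᵐ[ageMeasure L] f) (k l : ℝ) :
    (k • e - l • volterra e v : AgeL1 L) =ᵐ[ageMeasure L]
      fun x => f x * (k - l * primitive L x v) := by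
  filter_upwards [Lp.coeFn_sub (k • e) (l • volterra e v), Lp.coeFn_smul k e,
    Lp.coeFn_smul l (volterra e v), coeFn_volterra e v, he] with x h1 h2 h3 h4 h5
  rw [h1, Pi.sub_apply, h2, h3, Pi.smul_apply, Pi.smul_apply, h4, h5, smul_eq_mul, smul_eq_mul]
  ring

theorem primitive_eq_integral_of_ae {L : ℝ} (hL : 0 < L) {v : AgeL1 L} {P : ℝ → ℝ}
    (h : v =ᵐ[ageMeasure L] P) : primitive L L v = ∫ x in (0 : ℝ)..L, P x := by
  rw [primitive_eq (right_mem_Icc.2 hL.le), ← integral_ageMeasure hL.le, integral_congr_ae h,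
    integral_ageMeasure hL.le]

section

variable {lam1 lam2 L ps₀ : ℝ} {ps₁ ps₂ : ℝ → ℝ}

theorem IsDesiredState.profile₁ (hps : IsDesiredState lam1 lam2 L ps₀ ps₁ ps₂) (hL : 0 < L) :
    IsProfile L ps₁ := by
  obtain ⟨ε, hε, h⟩ := hps.deriv₁
  refine .of_deriv_neg hL hps.ac₁ hps.vanish₁ ?_
  filter_upwards [h] with x hx
  linarith

theorem IsDesiredState.profile₂ (hps : IsDesiredState lam1 lam2 L ps₀ ps₁ ps₂) (hL : 0 < L) :
    IsProfile L ps₂ :=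
  .of_deriv_neg hL hps.ac₂ hps.vanish₂ hps.deriv₂

theorem IsProfile.integral_pos (hL : 0 < L) {f : ℝ → ℝ} (hf : IsProfile L f) :
    0 < ∫ x in (0 : ℝ)..L, f x :=
  intervalIntegral.intervalIntegral_pos_of_pos_on
    (hf.ac.continuousOn.intervalIntegrable (μ := volume))
    (fun x hx => hf.pos x ⟨hx.1.le, hx.2⟩) hL

theorem IsDesiredState.ps₀_pos (hps : IsDesiredState lam1 lam2 L ps₀ ps₁ ps₂) (hL : 0 < L)
    (hlam1 : 0 < lam1) : 0 < ps₀ := by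
  have h := (hps.profile₁ hL).pos 0 ⟨le_rfl, hL⟩
  rw [hps.boundary₁] at h
  exact pos_of_mul_pos_right h hlam1.le

theorem closedLoop_iff (hps : IsDesiredState lam1 lam2 L ps₀ ps₁ ps₂) (hL : 0 < L)
    (hlam1 : 0 < lam1) (hlam2 : 0 < lam2) {α₁ α₂ w : ℝ} (hα₁ : 0 < α₁) (hα₂ : 0 < α₂) (hw : 0 < w)
    {e₁ e₂ : AgeL1 L} (he₁ : e₁ =ᵐ[ageMeasure L] ps₁) (he₂ : e₂ =ᵐ[ageMeasure L] ps₂)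
    (p v : RepairState L) :
    ClosedLoop lam1 lam2 L ps₁ ps₂ α₁ α₂ w p v ↔
      graphMap ps₀ (ps₀ + ∫ x in (0 : ℝ)..L, ps₁ x) (α₁ * w) (α₂ * w) e₁ e₂ (p, v) = 0 := by
  have hf₁ := hps.profile₁ hL
  have hf₂ := hps.profile₂ hL
  have ha := hps.ps₀_pos hL hlam1
  have hA : 0 < ps₀ + ∫ x in (0 : ℝ)..L, ps₁ x := add_pos ha (hf₁.integral_pos hL)
  have hb₁ := hps.boundary₁
  have hb₂ : ps₂ 0 = lam2 * (ps₀ + ∫ x in (0 : ℝ)..L, ps₁ x) := by rw [hps.boundary₂]; ring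
  set A := ps₀ + ∫ x in (0 : ℝ)..L, ps₁ x
  rw [graphMap_eq_zero_iff]
  constructor
  · rintro ⟨P₁, P₂, hp₁, hp₂, h⟩
    have hv₂ : ∀ᵐ x ∂(ageMeasure L),
        v.2.2 x = -(deriv P₂ x + (feedbackRate α₂ w 0 ps₂ P₂ x + 0) * P₂ x) := by
      simpa only [add_zero] using h.eq₂
    have k₁ := hf₁.eq_of_feedback hL hα₁ hw h.ac₁ h.eq₁
    have k₂ := hf₂.eq_of_feedback hL hα₂ hw h.ac₂ hv₂
    have z₁ : P₁ L = 0 := by rw [k₁ L (right_mem_Icc.2 hL.le), hf₁.vanish, zero_mul]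
    have z₂ : P₂ L = 0 := by rw [k₂ L (right_mem_Icc.2 hL.le), hf₂.vanish, zero_mul]
    have i₁ := (integral_feedback_mul hL h.ac₁ z₁ h.eq₁).2
    have i₂ := (integral_feedback_mul hL h.ac₂ z₂ hv₂).2
    refine ⟨?_, ?_, ?_⟩
    · rw [h.eq₀, i₁, i₂, h.boundary₁, h.boundary₂]
      ring
    · refine Lp.ext ?_
      filter_upwards [hp₁, coeFn_smul_sub_smul_volterra e₁ v.2.1 he₁ (ps₀⁻¹ * p.1) (α₁ * w)⁻¹,
        ae_ageMeasure_mem_Ioo L] with x h1 h2 hx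
      rw [h1, h2, k₁ x ⟨hx.1.le, hx.2.le⟩, h.boundary₁, hb₁]
      congr 2
      field_simp
    · refine Lp.ext ?_
      filter_upwards [hp₂, coeFn_smul_sub_smul_volterra e₂ v.2.2 he₂
        (A⁻¹ * (p.1 + primitive L L p.2.1)) (α₂ * w)⁻¹, ae_ageMeasure_mem_Ioo L] with x h1 h2 hx
      rw [h1, h2, k₂ x ⟨hx.1.le, hx.2.le⟩, h.boundary₂, hb₂, primitive_eq_integral_of_ae hL hp₁]
      congr 2
      field_simp
  · rintro ⟨h₀, h₁, h₂⟩
    set P₁ : ℝ → ℝ := fun x =>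
      ps₁ x * (ps₀⁻¹ * p.1 - (α₁ * w)⁻¹ * ∫ y in (0 : ℝ)..x, v.2.1 y) with hP₁
    set P₂ : ℝ → ℝ := fun x => ps₂ x * (A⁻¹ * (p.1 + primitive L L p.2.1)
      - (α₂ * w)⁻¹ * ∫ y in (0 : ℝ)..x, v.2.2 y) with hP₂
    have hp₁ : p.2.1 =ᵐ[ageMeasure L] P₁ := by
      rw [h₁]
      filter_upwards [coeFn_smul_sub_smul_volterra e₁ v.2.1 he₁ (ps₀⁻¹ * p.1) (α₁ * w)⁻¹,
        ae_ageMeasure_mem_Ioo L] with x h2 hx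
      rw [h2, primitive_eq ⟨hx.1.le, hx.2.le⟩]
    have hp₂ : p.2.2 =ᵐ[ageMeasure L] P₂ := by
      rw [h₂]
      filter_upwards [coeFn_smul_sub_smul_volterra e₂ v.2.2 he₂
        (A⁻¹ * (p.1 + primitive L L p.2.1)) (α₂ * w)⁻¹, ae_ageMeasure_mem_Ioo L] with x h2 hx
      rw [h2, primitive_eq ⟨hx.1.le, hx.2.le⟩]
    obtain ⟨ac₁, ev₁⟩ := hf₁.feedback_of_eq hL lam2 hα₁ hw _ v.2.1 hP₁
    obtain ⟨ac₂, ev₂⟩ := hf₂.feedback_of_eq hL 0 hα₂ hw _ v.2.2 hP₂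
    have z₁ : P₁ L = 0 := by simp only [hP₁, hf₁.vanish, zero_mul]
    have z₂ : P₂ L = 0 := by simp only [hP₂, hf₂.vanish, zero_mul]
    obtain ⟨j₁, i₁⟩ := integral_feedback_mul hL ac₁ z₁ ev₁
    obtain ⟨j₂, i₂⟩ := integral_feedback_mul hL ac₂ z₂ ev₂
    have b₁ : P₁ 0 = lam1 * p.1 := by
      simp only [hP₁, intervalIntegral.integral_same, hb₁]
      field_simp
      ring
    have b₂ : P₂ 0 = lam2 * p.1 + lam2 * ∫ x in (0 : ℝ)..L, P₁ x := by
      rw [← primitive_eq_integral_of_ae hL hp₁]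
      simp only [hP₂, intervalIntegral.integral_same, hb₂]
      field_simp
      ring
    refine ⟨P₁, P₂, hp₁, hp₂, ac₁, ac₂, j₁, j₂, b₁, b₂, ?_, ev₁, ?_⟩
    · rw [i₁, i₂, b₁, b₂]
      linear_combination h₀
    · simpa only [add_zero] using ev₂

end

/-- The bilinear form `(f, g) ↦ ∫₀ᴸ f(x) ∫₀ˣ g`. -/
def primitiveForm (L : ℝ) : AgeL1 L →L[ℝ] AgeL1 L →L[ℝ] ℝ :=
  LinearMap.mkContinuous₂
    (LinearMap.mk₂ ℝ (fun f g => ∫ x, f x * primitive L x g ∂(ageMeasure L))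
      (fun f f' g => by
        rw [← integral_add (integrable_mul_primitive f g) (integrable_mul_primitive f' g)]
        refine integral_congr_ae ?_
        filter_upwards [Lp.coeFn_add f f'] with x hx
        rw [hx, Pi.add_apply, add_mul])
      (fun k f g => by
        rw [smul_eq_mul, ← integral_const_mul]
        refine integral_congr_ae ?_
        filter_upwards [Lp.coeFn_smul k f] with x hx
        rw [hx, Pi.smul_apply, smul_eq_mul, mul_assoc])
      (fun f g g' => by
        rw [← integral_add (integrable_mul_primitive f g) (integrable_mul_primitive f g')]
        simp only [map_add, mul_add])
      (fun k f g => by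
        rw [smul_eq_mul, ← integral_const_mul]
        simp only [map_smul, smul_eq_mul, mul_left_comm])) 1
    fun f g => by
      rw [one_mul]
      refine (norm_integral_le_integral_norm _).trans ?_
      have h := norm_toL1_mul_primitive_le f g
      rwa [L1.norm_of_fun_eq_integral_norm] at h

theorem primitiveForm_apply {L : ℝ} (f g : AgeL1 L) :
    primitiveForm L f g = ∫ x, f x * primitive L x g ∂(ageMeasure L) := rfl

theorem primitiveForm_self {L : ℝ} (hL : 0 < L) (f : AgeL1 L) :
    2 * primitiveForm L f f = primitive L L f ^ 2 := by
  have hfi := f.intervalIntegrable (left_mem_Icc.2 hL.le) (right_mem_Icc.2 hL.le)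
  have hac := hfi.absolutelyContinuousOnInterval_intervalIntegral (left_mem_uIcc)
  have h1 := AbsolutelyContinuousOnInterval.integral_deriv_mul_eq_sub hac hac
  have h2 : ∫ x in (0 : ℝ)..L, (deriv (fun x => ∫ y in (0 : ℝ)..x, f y) x * (∫ y in (0 : ℝ)..x, f y)
      + (∫ y in (0 : ℝ)..x, f y) * deriv (fun x => ∫ y in (0 : ℝ)..x, f y) x)
      = ∫ x, 2 * (f x * primitive L x f) ∂(ageMeasure L) := by
    rw [← integral_ageMeasure hL.le]
    refine integral_congr_ae ?_
    filter_upwards [ae_ageMeasure_mem_Ioo L, ae_restrict_of_ae hfi.ae_hasDerivAt_integral]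
      with x hx h2
    rw [uIcc_of_le hL.le] at h2
    have h3 := h2 ⟨hx.1.le, hx.2.le⟩ 0 (left_mem_Icc.2 hL.le)
    rw [h3.deriv, primitive_eq ⟨hx.1.le, hx.2.le⟩]
    ring
  rw [h2, integral_const_mul, ← primitiveForm_apply, intervalIntegral.integral_same,
    ← primitive_eq (right_mem_Icc.2 hL.le)] at h1
  rw [h1]
  ring

theorem integrable_mul_affine_primitive {L : ℝ} (f g : AgeL1 L) (k l : ℝ) :
    Integrable (fun x => f x * (k - l * primitive L x g)) (ageMeasure L) := by
  refine ((f.integrable.mul_const k).sub ((integrable_mul_primitive f g).const_mul l)).congr ?_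
  refine Filter.Eventually.of_forall fun x => ?_
  simp only [Pi.sub_apply]
  ring

theorem integral_mul_affine_primitive {L : ℝ} (hL : 0 < L) (f g : AgeL1 L) (k l : ℝ) :
    ∫ x, f x * (k - l * primitive L x g) ∂(ageMeasure L) =
      k * primitive L L f - l * primitiveForm L f g := by
  have h : ∀ x, f x * (k - l * primitive L x g) = k * f x - l * (f x * primitive L x g) :=
    fun x => by ring
  simp_rw [h]
  rw [integral_sub (f.integrable.const_mul k) ((integrable_mul_primitive f g).const_mul l),
    integral_const_mul, integral_const_mul, ← primitiveForm_apply,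
    primitive_eq (right_mem_Icc.2 hL.le), integral_ageMeasure hL.le]

/-- Uniqueness for the transport equation `D = e U`, `∂ₜ D = -l⁻¹ ∂ₓ U` with zero initial value and
inflow `U(0) = -κ ∫ D`, by an energy estimate for `∫ e U²`. -/
theorem eq_zero_of_transport {L : ℝ} (hL : 0 < L) {e : AgeL1 L} (he : 0 ≤ᵐ[ageMeasure L] e)
    (hY : 0 < primitive L L e) {κ l : ℝ} (hl : 0 < l) {a b : ℝ} (hab : a < b) {u : ℝ → AgeL1 L}
    (hu : Continuous u)
    (h : ∀ t ∈ Icc a b, (∫ s in a..t, u s) =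
      (-κ * primitive L L (∫ s in a..t, u s)) • e - l • volterra e (u t)) :
    ∀ t ∈ Icc a b, u t = 0 := by
  set D : ℝ → AgeL1 L := fun t => ∫ s in a..t, u s with hD
  set m := primitive L L with hm
  set B := primitiveForm L with hB
  have hDd : ∀ t, HasDerivAt D (u t) t := fun t => hu.integral_hasStrictDerivAt a t |>.hasDerivAt
  have hDc : Continuous D := continuous_iff_continuousAt.2 fun t => (hDd t).continuousAt
  have hDe : ∀ t ∈ Icc a b, D t =ᵐ[ageMeasure L]
      fun x => e x * (-κ * m (D t) - l * primitive L x (u t)) := fun t ht => by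
    have h1 := coeFn_smul_sub_smul_volterra e (u t) (Filter.EventuallyEq.rfl) (-κ * m (D t)) l
    rwa [← h t ht] at h1
  have hsymm : ∀ s ∈ Icc a b, ∀ t ∈ Icc a b, B (D s) (u t) = B (D t) (u s) := by
    intro s hs t ht
    have h1 := integral_mul_affine_primitive hL (D s) (u t) (-κ * m (D t)) l
    have h2 := integral_mul_affine_primitive hL (D t) (u s) (-κ * m (D s)) l
    have h3 : ∫ x, D s x * (-κ * m (D t) - l * primitive L x (u t)) ∂(ageMeasure L)
        = ∫ x, D t x * (-κ * m (D s) - l * primitive L x (u s)) ∂(ageMeasure L) := by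
      refine integral_congr_ae ?_
      filter_upwards [hDe s hs, hDe t ht] with x h4 h5
      rw [h4, h5]
      ring
    rw [h1, h2, ← hm, ← hB] at h3
    have h4 : l * (B (D s) (u t) - B (D t) (u s)) = 0 := by linear_combination -h3
    exact sub_eq_zero.1 ((mul_eq_zero.1 h4).resolve_left hl.ne')
  set E : ℝ → ℝ := fun t => -κ * m (D t) * m (D t) - l * B (D t) (u t) with hE
  have hEc : Continuous E :=
    ((continuous_const.mul (m.continuous.comp hDc)).mul (m.continuous.comp hDc)).sub
      (continuous_const.mul ((B.continuous.comp hDc).clm_apply hu))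
  have hEint : ∀ t, ∫ x, D t x * (-κ * m (D t) - l * primitive L x (u t)) ∂(ageMeasure L) = E t :=
    fun t => integral_mul_affine_primitive hL _ _ _ _
  have hE0 : ∀ t ∈ Icc a b, m (D t) ^ 2 ≤ m e * E t := by
    intro t ht
    set k := m (D t) / m e with hk
    have h1 : 0 ≤ ∫ x, (D t x * (-κ * m (D t) - l * primitive L x (u t)) - (2 * k) * D t x
        + k ^ 2 * e x) ∂(ageMeasure L) := by
      refine integral_nonneg_of_ae ?_
      filter_upwards [hDe t ht, he] with x h2 h3
      rw [h2]
      have : 0 ≤ e x * (-κ * m (D t) - l * primitive L x (u t) - k) ^ 2 :=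
        mul_nonneg h3 (sq_nonneg _)
      simp only [Pi.zero_apply]
      nlinarith [this]
    have hi1 := integrable_mul_affine_primitive (D t) (u t) (-κ * m (D t)) l
    have hi2 := (D t).integrable.const_mul (2 * k)
    have hi3 : Integrable (fun x => D t x * (-κ * m (D t) - l * primitive L x (u t))
        - 2 * k * D t x) (ageMeasure L) := hi1.sub hi2
    rw [integral_add hi3 (e.integrable.const_mul _), integral_sub hi1 hi2, hEint t,
      integral_const_mul, integral_const_mul, integral_ageMeasure hL.le,
      integral_ageMeasure hL.le, ← primitive_eq (right_mem_Icc.2 hL.le),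
      ← primitive_eq (right_mem_Icc.2 hL.le), ← hm] at h1
    have h2 : m (D t) = k * m e := by rw [hk]; field_simp
    rw [h2] at h1 ⊢
    nlinarith [mul_nonneg hY.le h1]
  have hEd : ∀ t ∈ Ioo a b, HasDerivAt E
      (-κ * (m (u t) * (m (D t) + m (D t))) - l * B (u t) (u t + u t)) t := by
    intro t ht
    rw [hasDerivAt_iff_tendsto_slope]
    have hs := hasDerivAt_iff_tendsto_slope.1 (hDd t)
    have hu' : Filter.Tendsto u (nhdsWithin t {t}ᶜ) (nhds (u t)) :=
      hu.continuousAt.tendsto.mono_left nhdsWithin_le_nhds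
    have hD' : Filter.Tendsto D (nhdsWithin t {t}ᶜ) (nhds (D t)) :=
      hDc.continuousAt.tendsto.mono_left nhdsWithin_le_nhds
    have l1 := (m.continuous.tendsto _).comp hs
    have l2 := (m.continuous.tendsto _).comp hD'
    have l3 := (B.continuous₂.tendsto (u t, u t + u t)).comp
      (hs.prodMk_nhds (hu'.add_const (u t)))
    refine (((l1.mul (l2.add_const (m (D t)))).const_mul (-κ)).sub (l3.const_mul l)).congr' ?_
    filter_upwards [nhdsWithin_le_nhds (Ioo_mem_nhds ht.1 ht.2)] with s hs
    have hsy := hsymm s ⟨hs.1.le, hs.2.le⟩ t ⟨ht.1.le, ht.2.le⟩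
    simp only [Function.comp, Function.uncurry, slope_def_module, map_smul, map_sub, map_add, hE,
      _root_.smul_apply, _root_.sub_apply, smul_eq_mul]
    linear_combination (-l * (s - t)⁻¹) * hsy
  have hanti : AntitoneOn (fun t => Real.exp (-(κ ^ 2 / l * m e) * t) * E t) (Icc a b) := by
    have hexp : ∀ t, HasDerivAt (fun t => Real.exp (-(κ ^ 2 / l * m e) * t))
        (Real.exp (-(κ ^ 2 / l * m e) * t) * -(κ ^ 2 / l * m e)) t := fun t => by
      simpa using ((hasDerivAt_id t).const_mul (-(κ ^ 2 / l * m e))).exp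
    refine antitoneOn_of_deriv_nonpos (convex_Icc a b)
      ((Continuous.mul (by fun_prop) hEc).continuousOn) ?_ ?_
    · rw [interior_Icc]
      exact fun t ht => ((hexp t).fun_mul (hEd t ht)).differentiableAt.differentiableWithinAt
    · rw [interior_Icc]
      intro t ht
      rw [((hexp t).fun_mul (hEd t ht)).deriv]
      have h1 := primitiveForm_self hL (u t)
      rw [← hB, ← hm] at h1
      have h2 := hE0 t ⟨ht.1.le, ht.2.le⟩
      have h3 : -κ * (m (u t) * (m (D t) + m (D t))) - l * B (u t) (u t + u t)
          ≤ κ ^ 2 / l * m (D t) ^ 2 := by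
        rw [map_add]
        have h4 : κ ^ 2 / l * m (D t) ^ 2 - (-κ * (m (u t) * (m (D t) + m (D t)))
            - l * (B (u t) (u t) + B (u t) (u t))) = (κ * m (D t) + l * m (u t)) ^ 2 / l := by
          field_simp
          linear_combination l ^ 2 * h1
        have : 0 ≤ (κ * m (D t) + l * m (u t)) ^ 2 / l := by positivity
        linarith
      have h5 : κ ^ 2 / l * m (D t) ^ 2 ≤ κ ^ 2 / l * (m e * E t) :=
        mul_le_mul_of_nonneg_left h2 (by positivity)
      have h6 : 0 < Real.exp (-(κ ^ 2 / l * m e) * t) := Real.exp_pos _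
      nlinarith [mul_nonneg h6.le (sub_nonneg.2 (h3.trans h5))]
  have hDa : D a = 0 := intervalIntegral.integral_same
  have hEa : E a = 0 := by simp [hE, hDa]
  have hDz : ∀ t ∈ Icc a b, D t = 0 := by
    intro t ht
    have h1 := hanti (left_mem_Icc.2 hab.le) ht ht.1
    simp only [hEa, mul_zero] at h1
    have h2 : E t ≤ 0 := by
      by_contra hc
      push Not at hc
      have := mul_pos (Real.exp_pos (-(κ ^ 2 / l * m e) * t)) hc
      linarith
    have h3 : 0 ≤ᵐ[ageMeasure L] fun x => D t x * (-κ * m (D t) - l * primitive L x (u t)) := by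
      filter_upwards [hDe t ht, he] with x h4 h5
      rw [h4]
      simp only [Pi.zero_apply]
      rw [mul_assoc]
      exact mul_nonneg h5 (mul_self_nonneg _)
    have h4 : E t = 0 := le_antisymm h2 (by rw [← hEint]; exact integral_nonneg_of_ae h3)
    rw [← hEint, integral_eq_zero_iff_of_nonneg_ae h3
      (integrable_mul_affine_primitive _ _ _ _)] at h4
    rw [Lp.eq_zero_iff_ae_eq_zero]
    filter_upwards [hDe t ht, h4] with x h5 h6
    simp only [Pi.zero_apply] at h6 ⊢
    rcases mul_eq_zero.1 h6 with h7 | h7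
    · exact h7
    · rw [h5, h7, mul_zero]
  have hz : EqOn u 0 (Ioo a b) := fun t ht => by
    refine (hDd t).unique ((hasDerivAt_const t (0 : AgeL1 L)).congr_of_eventuallyEq ?_)
    filter_upwards [Ioo_mem_nhds ht.1 ht.2] with s hs
    exact hDz s ⟨hs.1.le, hs.2.le⟩
  have hz' := hz.closure hu continuous_const
  rw [closure_Ioo hab.ne] at hz'
  exact hz'

section

variable {L : ℝ} {a A c₁ c₂ : ℝ} {e₁ e₂ : AgeL1 L}

/-- The total mass `p₀ + ∫ p₁ + ∫ p₂` of a state. -/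
def totalMass (L : ℝ) : RepairState L →L[ℝ] ℝ :=
  ContinuousLinearMap.fst ℝ _ _ +
    (primitive L L).comp ((ContinuousLinearMap.fst ℝ _ _).comp (ContinuousLinearMap.snd ℝ _ _)) +
    (primitive L L).comp ((ContinuousLinearMap.snd ℝ _ _).comp (ContinuousLinearMap.snd ℝ _ _))

theorem totalMass_apply (p : RepairState L) :
    totalMass L p = p.1 + primitive L L p.2.1 + primitive L L p.2.2 := rfl

theorem fst_intervalIntegral {d : ℝ → RepairState L} (hd : Continuous d) (s t : ℝ) :
    (∫ r in s..t, d r).1 = ∫ r in s..t, (d r).1 :=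
  ((ContinuousLinearMap.fst ℝ ℝ (AgeL1 L × AgeL1 L)).intervalIntegral_comp_comm
    (hd.intervalIntegrable s t)).symm

theorem snd_fst_intervalIntegral {d : ℝ → RepairState L} (hd : Continuous d) (s t : ℝ) :
    (∫ r in s..t, d r).2.1 = ∫ r in s..t, (d r).2.1 :=
  (((ContinuousLinearMap.fst ℝ (AgeL1 L) (AgeL1 L)).comp
    (ContinuousLinearMap.snd ℝ ℝ (AgeL1 L × AgeL1 L))).intervalIntegral_comp_comm
    (hd.intervalIntegrable s t)).symm

theorem snd_snd_intervalIntegral {d : ℝ → RepairState L} (hd : Continuous d) (s t : ℝ) :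
    (∫ r in s..t, d r).2.2 = ∫ r in s..t, (d r).2.2 :=
  (((ContinuousLinearMap.snd ℝ (AgeL1 L) (AgeL1 L)).comp
    (ContinuousLinearMap.snd ℝ ℝ (AgeL1 L × AgeL1 L))).intervalIntegral_comp_comm
    (hd.intervalIntegrable s t)).symm

/-- The graph of the closed-loop operator is stable under integration. -/
theorem graphMap_intervalIntegral {R Q : ℝ → RepairState L} (hR : Continuous R)
    (hQ : Continuous Q) {s t : ℝ} (hst : s ≤ t)
    (h : ∀ r ∈ Icc s t, graphMap a A c₁ c₂ e₁ e₂ (R r, Q r) = 0) :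
    graphMap a A c₁ c₂ e₁ e₂ (∫ r in s..t, R r, ∫ r in s..t, Q r) = 0 := by
  have hi : IntervalIntegrable (fun r => (R r, Q r)) volume s t :=
    (hR.prodMk hQ).intervalIntegrable s t
  have h1 := (graphMap a A c₁ c₂ e₁ e₂).intervalIntegral_comp_comm hi
  have h2 := (ContinuousLinearMap.fst ℝ (RepairState L) (RepairState L)).intervalIntegral_comp_comm hi
  have h3 := (ContinuousLinearMap.snd ℝ (RepairState L) (RepairState L)).intervalIntegral_comp_comm hi
  have h4 : (∫ r in s..t, R r, ∫ r in s..t, Q r) = ∫ r in s..t, (R r, Q r) := Prod.ext h2 h3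
  rw [h4, ← h1]
  refine intervalIntegral.integral_zero_ae (Filter.Eventually.of_forall fun r hr => ?_)
  rw [uIoc_of_le hst] at hr
  exact h r ⟨hr.1.le, hr.2⟩

theorem graphMap_unique (hL : 0 < L) (he₁ : 0 ≤ᵐ[ageMeasure L] e₁) (he₂ : 0 ≤ᵐ[ageMeasure L] e₂)
    (hY₁ : 0 < primitive L L e₁) (hY₂ : 0 < primitive L L e₂) (hc₁ : 0 < c₁) (hc₂ : 0 < c₂)
    {t₀ t₁ : ℝ} (ht : t₀ < t₁) {d : ℝ → RepairState L} (hd : ContinuousOn d (Icc t₀ t₁))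
    (h : ∀ t ∈ Icc t₀ t₁, graphMap a A c₁ c₂ e₁ e₂ (∫ s in t₀..t, d s, d t) = 0) :
    ∀ t ∈ Icc t₀ t₁, d t = 0 := by
  set d' : ℝ → RepairState L := IccExtend ht.le ((Icc t₀ t₁).domRestrict d) with hd'
  have hc : Continuous d' := hd.domRestrict.Icc_extend'
  have hdd : ∀ t ∈ Icc t₀ t₁, d' t = d t := fun t ht' => IccExtend_of_mem ht.le _ ht'
  have hm : ∀ t ∈ Icc t₀ t₁, totalMass L (d' t) = 0 := fun t ht' => by
    rw [hdd t ht', totalMass_apply]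
    exact ((graphMap_eq_zero_iff _ _ _ _ _ _ _ _).1 (h t ht')).1
  have hint : ∀ t ∈ Icc t₀ t₁, ∫ s in t₀..t, d s = ∫ s in t₀..t, d' s := fun t ht' => by
    refine intervalIntegral.integral_congr fun s hs => ?_
    rw [uIcc_of_le ht'.1] at hs
    exact (hdd s ⟨hs.1, hs.2.trans ht'.2⟩).symm
  have hM : ∀ t ∈ Icc t₀ t₁, (∫ s in t₀..t, (d' s).1) + primitive L L (∫ s in t₀..t, (d' s).2.1)
      + primitive L L (∫ s in t₀..t, (d' s).2.2) = 0 := fun t ht' => by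
    rw [← fst_intervalIntegral hc, ← snd_fst_intervalIntegral hc, ← snd_snd_intervalIntegral hc,
      ← totalMass_apply, ← (totalMass L).intervalIntegral_comp_comm (hc.intervalIntegrable _ _)]
    refine intervalIntegral.integral_zero_ae (Filter.Eventually.of_forall fun s hs => ?_)
    rw [uIoc_of_le ht'.1] at hs
    exact hm s ⟨hs.1.le, hs.2.trans ht'.2⟩
  have hg : ∀ t ∈ Icc t₀ t₁,
      (∫ s in t₀..t, (d' s).2.1) =
        (a⁻¹ * ∫ s in t₀..t, (d' s).1) • e₁ - c₁⁻¹ • volterra e₁ (d' t).2.1 ∧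
      (∫ s in t₀..t, (d' s).2.2) =
        (A⁻¹ * ((∫ s in t₀..t, (d' s).1) + primitive L L (∫ s in t₀..t, (d' s).2.1))) • e₂
          - c₂⁻¹ • volterra e₂ (d' t).2.2 := fun t ht' => by
    have h1 := ((graphMap_eq_zero_iff _ _ _ _ _ _ _ _).1 (h t ht')).2
    rwa [hint t ht', fst_intervalIntegral hc, snd_fst_intervalIntegral hc,
      snd_snd_intervalIntegral hc, ← hdd t ht'] at h1
  have z₂ : ∀ t ∈ Icc t₀ t₁, (d' t).2.2 = 0 := by
    refine eq_zero_of_transport hL he₂ hY₂ (κ := A⁻¹) (inv_pos.2 hc₂) ht hc.snd.snd fun t ht' => ?_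
    have h1 : -A⁻¹ * primitive L L (∫ s in t₀..t, (d' s).2.2) =
        A⁻¹ * ((∫ s in t₀..t, (d' s).1) + primitive L L (∫ s in t₀..t, (d' s).2.1)) := by
      linear_combination -A⁻¹ * hM t ht'
    rw [h1]
    exact (hg t ht').2
  have z₂' : ∀ t ∈ Icc t₀ t₁, (∫ s in t₀..t, (d' s).2.2) = 0 := fun t ht' => by
    refine intervalIntegral.integral_zero_ae (Filter.Eventually.of_forall fun s hs => ?_)
    rw [uIoc_of_le ht'.1] at hs
    exact z₂ s ⟨hs.1.le, hs.2.trans ht'.2⟩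
  have z₁ : ∀ t ∈ Icc t₀ t₁, (d' t).2.1 = 0 := by
    refine eq_zero_of_transport hL he₁ hY₁ (κ := a⁻¹) (inv_pos.2 hc₁) ht hc.snd.fst fun t ht' => ?_
    have h0 := hM t ht'
    rw [z₂' t ht', map_zero, add_zero] at h0
    have h1 : -a⁻¹ * primitive L L (∫ s in t₀..t, (d' s).2.1) =
        a⁻¹ * (∫ s in t₀..t, (d' s).1) := by
      linear_combination -a⁻¹ * h0
    rw [h1]
    exact (hg t ht').1
  intro t ht'
  have h1 := hm t ht'
  rw [totalMass_apply, z₁ t ht', z₂ t ht', map_zero, add_zero, add_zero] at h1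
  rw [← hdd t ht']
  exact Prod.ext h1 (Prod.ext (z₁ t ht') (z₂ t ht'))

theorem graphMap_sub {p p' v v' : RepairState L} (h : graphMap a A c₁ c₂ e₁ e₂ (p, v) = 0)
    (h' : graphMap a A c₁ c₂ e₁ e₂ (p', v') = 0) :
    graphMap a A c₁ c₂ e₁ e₂ (p - p', v - v') = 0 := by
  rw [← Prod.mk_sub_mk, map_sub, h, h', sub_zero]

theorem graphMap_add {p p' v v' : RepairState L} (h : graphMap a A c₁ c₂ e₁ e₂ (p, v) = 0)
    (h' : graphMap a A c₁ c₂ e₁ e₂ (p', v') = 0) :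
    graphMap a A c₁ c₂ e₁ e₂ (p + p', v + v') = 0 := by
  rw [← Prod.mk_add_mk, map_add, h, h', add_zero]

/-- Two mild solutions that agree initially agree. -/
theorem mild_unique (hL : 0 < L) (he₁ : 0 ≤ᵐ[ageMeasure L] e₁) (he₂ : 0 ≤ᵐ[ageMeasure L] e₂)
    (hY₁ : 0 < primitive L L e₁) (hY₂ : 0 < primitive L L e₂) (hc₁ : 0 < c₁) (hc₂ : 0 < c₂)
    {t₀ t₁ : ℝ} (ht : t₀ < t₁) {p q : ℝ → RepairState L} (hp : ContinuousOn p (Icc t₀ t₁))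
    (hq : ContinuousOn q (Icc t₀ t₁)) (h0 : p t₀ = q t₀)
    (hp' : ∀ t ∈ Icc t₀ t₁, graphMap a A c₁ c₂ e₁ e₂ (∫ s in t₀..t, p s, p t - p t₀) = 0)
    (hq' : ∀ t ∈ Icc t₀ t₁, graphMap a A c₁ c₂ e₁ e₂ (∫ s in t₀..t, q s, q t - q t₀) = 0) :
    ∀ t ∈ Icc t₀ t₁, p t = q t := by
  intro t ht'
  refine sub_eq_zero.1 (graphMap_unique hL he₁ he₂ hY₁ hY₂ hc₁ hc₂ ht (a := a) (A := A)
    (hp.sub hq) (fun r hr => ?_) t ht')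
  have hs : uIcc t₀ r ⊆ Icc t₀ t₁ := by
    rw [uIcc_of_le hr.1]; exact Icc_subset_Icc_right hr.2
  have h1 := graphMap_sub (hp' r hr) (hq' r hr)
  rw [h0, sub_sub_sub_cancel_right] at h1
  simp only [Pi.sub_apply]
  rw [intervalIntegral.integral_sub ((hp.mono hs).intervalIntegrable)
    ((hq.mono hs).intervalIntegrable)]
  exact h1

/-- If the initial state `φ` lies in the domain of the operator, with image `v`, then the mild
solution with initial state `φ` is the primitive of the mild solution with initial state `v`. -/
theorem mild_eq_add_integral (hL : 0 < L) (he₁ : 0 ≤ᵐ[ageMeasure L] e₁)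
    (he₂ : 0 ≤ᵐ[ageMeasure L] e₂) (hY₁ : 0 < primitive L L e₁) (hY₂ : 0 < primitive L L e₂)
    (hc₁ : 0 < c₁) (hc₂ : 0 < c₂) {P Q : ℝ → RepairState L} (hP : Continuous P)
    (hQ : Continuous Q)
    (hP' : ∀ t, 0 ≤ t → graphMap a A c₁ c₂ e₁ e₂ (∫ s in (0 : ℝ)..t, P s, P t - P 0) = 0)
    (hQ' : ∀ t, 0 ≤ t → graphMap a A c₁ c₂ e₁ e₂ (∫ s in (0 : ℝ)..t, Q s, Q t - Q 0) = 0)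
    (hv : graphMap a A c₁ c₂ e₁ e₂ (P 0, Q 0) = 0) {t : ℝ} (ht : 0 ≤ t) :
    P t = P 0 + ∫ s in (0 : ℝ)..t, Q s ∧ graphMap a A c₁ c₂ e₁ e₂ (P t, Q t) = 0 := by
  set R : ℝ → RepairState L := fun t => P 0 + ∫ s in (0 : ℝ)..t, Q s with hR
  have hRc : Continuous R := continuous_const.add
    (intervalIntegral.continuous_primitive (fun a b => hQ.intervalIntegrable a b) 0)
  have hR0 : R 0 = P 0 := by simp [hR]
  have hRQ : ∀ t, 0 ≤ t → graphMap a A c₁ c₂ e₁ e₂ (R t, Q t) = 0 := fun t ht => by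
    have h1 := graphMap_add hv (hQ' t ht)
    rwa [add_sub_cancel] at h1
  have hRm : ∀ t, 0 ≤ t → graphMap a A c₁ c₂ e₁ e₂ (∫ s in (0 : ℝ)..t, R s, R t - R 0) = 0 :=
    fun t ht => by
      rw [hR0, hR]
      simp only [add_sub_cancel_left]
      exact graphMap_intervalIntegral hRc hQ ht fun r hr => hRQ r hr.1
  have key : P t = R t := mild_unique hL he₁ he₂ hY₁ hY₂ hc₁ hc₂ (ht.trans_lt (lt_add_one t))
    hP.continuousOn hRc.continuousOn hR0.symm (fun r hr => hP' r hr.1) (fun r hr => hRm r hr.1) t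
    ⟨ht, (lt_add_one t).le⟩
  exact ⟨key, key ▸ hRQ t ht⟩

end

end

open Filter Topology

noncomputable section

theorem abs_integral_exp_mul_le {g M x y : ℝ} (hg : 0 < g) (hM : 0 ≤ M) (hxy : x ≤ y) {h : ℝ → ℝ}
    (hh : ∀ s, |h s| ≤ M) : |∫ s in x..y, Real.exp (g * s) * h s| ≤ M * Real.exp (g * y) / g := by
  have hd : ∀ s, HasDerivAt (fun s => M * Real.exp (g * s) / g) (M * Real.exp (g * s)) s := by
    intro s
    have h1 := ((((hasDerivAt_id s).const_mul g).exp).const_mul M).div_const g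
    refine h1.congr_deriv ?_
    simp only [id, mul_one]
    field_simp
  have h1 : ∫ s in x..y, M * Real.exp (g * s)
      = M * Real.exp (g * y) / g - M * Real.exp (g * x) / g :=
    intervalIntegral.integral_eq_sub_of_hasDerivAt (fun s _ => hd s)
      ((by fun_prop : Continuous fun s => M * Real.exp (g * s)).intervalIntegrable _ _)
  have h2 : ‖∫ s in x..y, Real.exp (g * s) * h s‖ ≤ ∫ s in x..y, M * Real.exp (g * s) := by
    refine intervalIntegral.norm_integral_le_of_norm_le hxy (Eventually.of_forall fun s _ => ?_)
      ((by fun_prop : Continuous fun s => M * Real.exp (g * s)).intervalIntegrable _ _)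
    rw [norm_mul, Real.norm_of_nonneg (Real.exp_pos _).le, mul_comm]
    exact mul_le_mul_of_nonneg_right (hh s) (Real.exp_pos _).le
  rw [h1] at h2
  have h3 : 0 ≤ M * Real.exp (g * x) / g := by positivity
  rw [← Real.norm_eq_abs]
  linarith

open scoped BoundedContinuousFunction

theorem continuous_delayed_integral {g : ℝ} (T : ℝ) (b : ℝ →ᵇ ℝ) :
    Continuous fun t : ℝ =>
      ∫ s in (max (max t 0 - T) 0)..(max t 0), Real.exp (g * s) * b s := by
  have hi : ∀ x y, IntervalIntegrable (fun s => Real.exp (g * s) * b s) volume x y := fun x y =>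
    (Continuous.mul (by fun_prop) b.continuous).intervalIntegrable x y
  have hI : Continuous fun t => ∫ s in (0 : ℝ)..t, Real.exp (g * s) * b s :=
    intervalIntegral.continuous_primitive hi 0
  have he : ∀ t : ℝ, ∫ s in (max (max t 0 - T) 0)..(max t 0), Real.exp (g * s) * b s =
      (∫ s in (0 : ℝ)..(max t 0), Real.exp (g * s) * b s)
      - ∫ s in (0 : ℝ)..(max (max t 0 - T) 0), Real.exp (g * s) * b s := fun t =>
    (intervalIntegral.integral_interval_sub_left (hi _ _) (hi _ _)).symm
  simp_rw [he]
  refine Continuous.sub ?_ ?_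
  · exact hI.comp (by fun_prop : Continuous fun t : ℝ => max t 0)
  · exact hI.comp (by fun_prop : Continuous fun t : ℝ => max (max t 0 - T) 0)

theorem abs_delayed_integral_le {κ g T : ℝ} (hκ : 0 ≤ κ) (hg0 : 0 < g) (hT : 0 < T) (t : ℝ) {M : ℝ}
    {h : ℝ → ℝ} (hM : 0 ≤ M) (hh : ∀ s, |h s| ≤ M) :
    |κ * Real.exp (-g * max t 0) *
      ∫ s in (max (max t 0 - T) 0)..(max t 0), Real.exp (g * s) * h s| ≤ κ / g * M := by
  have h1 := abs_integral_exp_mul_le hg0 hM (x := max (max t 0 - T) 0) (y := max t 0)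
    (max_le (by linarith) (le_max_right _ _)) hh
  rw [abs_mul, abs_of_nonneg (mul_nonneg hκ (Real.exp_pos _).le)]
  calc κ * Real.exp (-g * max t 0) *
        |∫ s in (max (max t 0 - T) 0)..(max t 0), Real.exp (g * s) * h s|
      ≤ κ * Real.exp (-g * max t 0) * (M * Real.exp (g * max t 0) / g) :=
        mul_le_mul_of_nonneg_left h1 (mul_nonneg hκ (Real.exp_pos _).le)
    _ = κ / g * M * (Real.exp (-g * max t 0) * Real.exp (g * max t 0)) := by ring
    _ = κ / g * M := by rw [← Real.exp_add]; simp

/-- A Volterra equation with delay has a global solution in a space of exponentially weighted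
bounded continuous functions. -/
theorem exists_volterra_delay {κ g T : ℝ} (hκ : 0 ≤ κ) (hg : κ < g) {N : ℝ → ℝ}
    (hN : Continuous N) {C : ℝ} (hC : ∀ t, |N t| ≤ C) (hT : 0 < T) :
    ∃ b : ℝ →ᵇ ℝ, ∀ t, 0 ≤ t → b t = N t -
      κ * Real.exp (-g * t) * ∫ s in (max (t - T) 0)..t, Real.exp (g * s) * b s := by
  have hg0 : 0 < g := hκ.trans_lt hg
  obtain ⟨Ψ, hΨ⟩ : ∃ Ψ : (ℝ →ᵇ ℝ) → (ℝ →ᵇ ℝ), ∀ b t, Ψ b t = N t -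
      κ * Real.exp (-g * max t 0) *
        ∫ s in (max (max t 0 - T) 0)..(max t 0), Real.exp (g * s) * b s := by
    refine ⟨fun b => BoundedContinuousFunction.ofNormedAddCommGroup
      (fun t => N t - κ * Real.exp (-g * max t 0) *
        ∫ s in (max (max t 0 - T) 0)..(max t 0), Real.exp (g * s) * b s)
      (hN.sub (Continuous.mul (by fun_prop) (continuous_delayed_integral T b)))
      (C + κ / g * ‖b‖) fun t => ?_, fun b t => rfl⟩
    exact (norm_sub_le _ _).trans (add_le_add (hC t)
      (abs_delayed_integral_le hκ hg0 hT t (norm_nonneg _) b.norm_coe_le_norm))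
  have hlip : ContractingWith (Real.toNNReal (κ / g)) Ψ := by
    refine ⟨?_, LipschitzWith.of_dist_le_mul fun b b' => ?_⟩
    · rw [Real.toNNReal_lt_one, div_lt_one hg0]
      exact hg
    · rw [Real.coe_toNNReal _ (div_nonneg hκ hg0.le)]
      refine (BoundedContinuousFunction.dist_le
        (mul_nonneg (div_nonneg hκ hg0.le) dist_nonneg)).2 fun t => ?_
      have hi : ∀ (b : ℝ →ᵇ ℝ) x y,
          IntervalIntegrable (fun s => Real.exp (g * s) * b s) volume x y := fun b x y =>
        (Continuous.mul (by fun_prop) b.continuous).intervalIntegrable x y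
      have h1 := abs_delayed_integral_le hκ hg0 hT t (M := dist b b') (h := fun s => b' s - b s)
        dist_nonneg fun s => by
          rw [← Real.dist_eq, dist_comm]; exact BoundedContinuousFunction.dist_coe_le_dist s
      simp_rw [mul_sub] at h1
      rw [intervalIntegral.integral_sub (hi _ _ _) (hi _ _ _), mul_sub] at h1
      rw [hΨ, hΨ, Real.dist_eq, sub_sub_sub_cancel_left]
      exact h1
  obtain ⟨b, hb⟩ : ∃ b, Ψ b = b := ⟨_, hlip.fixedPoint_isFixedPt⟩
  refine ⟨b, fun t ht => ?_⟩
  have h1 := hΨ b t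
  rw [hb, max_eq_left ht] at h1
  exact h1

/-- Existence for the renewal equation `A β(t) + c ∫_{t-T}^t β = f(t)`, `t ≥ 0`, with prescribed
values of `β` at negative times. -/
theorem exists_renewal {A c T : ℝ} (hA : 0 < A) (hc : 0 < c) (hT : 0 < T) {β₀ : ℝ → ℝ}
    (hβ₀ : Integrable β₀) {f : ℝ → ℝ} (hf : ContinuousOn f (Ici 0)) {C γ : ℝ}
    (hfC : ∀ t, 0 ≤ t → |f t| ≤ C * Real.exp (γ * t)) :
    ∃ β : ℝ → ℝ, (∀ t < 0, β t = β₀ t) ∧ ContinuousOn β (Ici 0) ∧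
      (∃ C' γ', ∀ t, 0 ≤ t → |β t| ≤ C' * Real.exp (γ' * t)) ∧
      (∀ x y, IntervalIntegrable β volume x y) ∧
      ∀ t, 0 ≤ t → A * β t + c * ∫ s in (t - T)..t, β s = f t := by
  set κ := c / A with hκ
  have hκ0 : 0 < κ := div_pos hc hA
  set g := max γ 0 + κ + 1 with hg
  have hg0 : 0 ≤ max γ 0 := le_max_right _ _
  have hgγ : γ ≤ g := (le_max_left γ 0).trans (by linarith)
  set β₁ : ℝ → ℝ := (Iio 0).indicator β₀ with hβ₁
  have hβ₁i : Integrable β₁ := hβ₀.indicator measurableSet_Iio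
  have hIc : Continuous fun t => ∫ s in (0 : ℝ)..t, β₁ s :=
    intervalIntegral.continuous_primitive (fun _ _ => hβ₁i.intervalIntegrable) 0
  have hWc : Continuous fun t => ∫ s in (t - T)..t, β₁ s := by
    have he : ∀ t, ∫ s in (t - T)..t, β₁ s
        = (∫ s in (0 : ℝ)..t, β₁ s) - ∫ s in (0 : ℝ)..(t - T), β₁ s := fun t =>
      (intervalIntegral.integral_interval_sub_left hβ₁i.intervalIntegrable
        hβ₁i.intervalIntegrable).symm
    simp_rw [he]
    exact hIc.sub (hIc.comp (by fun_prop))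
  have hfc : Continuous fun t => f (max t 0) :=
    hf.comp_continuous (by fun_prop) fun t => le_max_right t 0
  set N : ℝ → ℝ := fun t => Real.exp (-g * max t 0) *
    (f (max t 0) - c * ∫ s in (max t 0 - T)..(max t 0), β₁ s) / A with hN
  have hNc : Continuous N := by
    refine Continuous.div_const (Continuous.mul (by fun_prop) (hfc.sub (continuous_const.mul ?_))) A
    exact hWc.comp (by fun_prop : Continuous fun t : ℝ => max t 0)
  have hNb : ∀ t, |N t| ≤ (|C| + c * ∫ s, |β₁ s|) / A := by
    intro t
    have ht : 0 ≤ max t 0 := le_max_right _ _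
    have h1 : |∫ s in (max t 0 - T)..(max t 0), β₁ s| ≤ ∫ s, |β₁ s| := by
      rw [intervalIntegral.integral_of_le (by linarith)]
      refine (norm_integral_le_integral_norm (fun s => β₁ s)).trans ?_
      exact setIntegral_le_integral hβ₁i.norm (Eventually.of_forall fun _ => norm_nonneg _)
    have h2 : Real.exp (-g * max t 0) ≤ 1 := Real.exp_le_one_iff.2 (by
      have : 0 ≤ g * max t 0 := mul_nonneg (by linarith) ht
      linarith)
    have h3 : Real.exp (-g * max t 0) * |f (max t 0)| ≤ |C| := by
      calc Real.exp (-g * max t 0) * |f (max t 0)|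
          ≤ Real.exp (-g * max t 0) * (|C| * Real.exp (g * max t 0)) := by
            refine mul_le_mul_of_nonneg_left ((hfC _ ht).trans ?_) (Real.exp_pos _).le
            refine mul_le_mul (le_abs_self C) ?_ (Real.exp_pos _).le (abs_nonneg _)
            exact Real.exp_le_exp.2 (mul_le_mul_of_nonneg_right hgγ ht)
        _ = |C| * (Real.exp (-g * max t 0) * Real.exp (g * max t 0)) := by ring
        _ = |C| := by rw [← Real.exp_add]; simp
    rw [hN]
    simp only
    rw [abs_div, abs_of_pos hA, abs_mul, abs_of_pos (Real.exp_pos _)]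
    refine div_le_div_of_nonneg_right ?_ hA.le
    have h4 := abs_sub (f (max t 0)) (c * ∫ s in (max t 0 - T)..(max t 0), β₁ s)
    rw [abs_mul, abs_of_pos hc] at h4
    have h5 : c * |∫ s in (max t 0 - T)..(max t 0), β₁ s| ≤ c * ∫ s, |β₁ s| :=
      mul_le_mul_of_nonneg_left h1 hc.le
    have h6 : 0 ≤ c * |∫ s in (max t 0 - T)..(max t 0), β₁ s| := by positivity
    nlinarith [Real.exp_pos (-g * max t 0),
      mul_le_mul_of_nonneg_left h4 (Real.exp_pos (-g * max t 0)).le,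
      mul_le_mul_of_nonneg_right h2 h6]
  obtain ⟨b, hb⟩ := exists_volterra_delay hκ0.le (show κ < g by linarith) hNc hNb hT
  set β₂ : ℝ → ℝ := (Ici 0).indicator fun s => Real.exp (g * s) * b s with hβ₂
  have hec : Continuous fun s => Real.exp (g * s) * b s := Continuous.mul (by fun_prop) b.continuous
  have hβ₂i : ∀ x y, IntervalIntegrable β₂ volume x y := fun x y => by
    rw [intervalIntegrable_iff]
    exact ((intervalIntegrable_iff.1 (hec.intervalIntegrable x y)).indicator measurableSet_Ici)
  have hβ₂e : ∀ s, 0 ≤ s → β₂ s = Real.exp (g * s) * b s := fun s hs =>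
    indicator_of_mem (mem_Ici.2 hs) _
  refine ⟨fun t => β₁ t + β₂ t, fun t ht => ?_, ?_, ⟨‖b‖, g, fun t ht => ?_⟩, fun x y => ?_,
    fun t ht => ?_⟩
  · simp [hβ₁, hβ₂, ht]
  · refine hec.continuousOn.congr fun t ht => ?_
    rw [mem_Ici] at ht
    simp [hβ₁, hβ₂, ht]
  · have : β₁ t = 0 := by simp [hβ₁, ht]
    simp only
    rw [this, zero_add, hβ₂e t ht, abs_mul, abs_of_pos (Real.exp_pos _), mul_comm]
    exact mul_le_mul_of_nonneg_right (b.norm_coe_le_norm t) (Real.exp_pos _).le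
  · exact hβ₁i.intervalIntegrable.add (hβ₂i x y)
  · simp only
    have hz : β₁ t = 0 := by simp [hβ₁, ht]
    have h1 : ∫ s in (t - T)..t, β₂ s = ∫ s in (max (t - T) 0)..t, Real.exp (g * s) * b s := by
      have hle : max (t - T) 0 ≤ t := max_le (by linarith) ht
      rw [← intervalIntegral.integral_add_adjacent_intervals (hβ₂i (t - T) (max (t - T) 0))
        (hβ₂i _ t)]
      have h2 : ∫ s in (t - T)..(max (t - T) 0), β₂ s = 0 := by
        rcases le_total 0 (t - T) with h | h
        · rw [max_eq_left h, intervalIntegral.integral_same]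
        · rw [max_eq_right h]
          refine intervalIntegral.integral_zero_ae ?_
          filter_upwards [measure_eq_zero_iff_ae_notMem.1 (measure_singleton (0 : ℝ))] with s hs hs'
          rw [uIoc_of_le h] at hs'
          have : s < 0 := lt_of_le_of_ne hs'.2 hs
          simp [hβ₂, this]
      rw [h2, zero_add]
      refine intervalIntegral.integral_congr fun s hs => ?_
      rw [uIcc_of_le hle] at hs
      exact hβ₂e s ((le_max_right _ _).trans hs.1)
    rw [intervalIntegral.integral_add hβ₁i.intervalIntegrable (hβ₂i _ _), h1, hz, zero_add,
      hβ₂e t ht, hb t ht]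
    simp only [hN, max_eq_left ht]
    have h3 : Real.exp (g * t) * Real.exp (-(g * t)) = 1 := by rw [← Real.exp_add]; simp
    set W := ∫ s in (t - T)..t, β₁ s
    set Z := ∫ s in (max (t - T) 0)..t, Real.exp (g * s) * b s
    rw [hκ]
    field_simp
    linear_combination (f t - c * W - c * Z) * h3

/-- Comparison for a delay equation: over a time span `T` the solution stays below its previous
maximum, and a fixed fraction of the gap persists. -/
theorem delay_le {κ T ε s M : ℝ} (hκ : 0 < κ) (hε : 0 ≤ ε) {h e : ℝ → ℝ}
    (hd : ∀ t ∈ Icc s (s + T), HasDerivAt h (κ * (h (t - T) - h t) + e t) t)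
    (he : ∀ t ∈ Icc s (s + T), e t ≤ ε) (hM : ∀ t ∈ Icc (s - T) s, h t ≤ M) :
    ∀ t ∈ Icc s (s + T), h t ≤ M - Real.exp (-κ * T) * (M - h s) + ε / κ := by
  intro t ht
  have hT : 0 ≤ T := by linarith [ht.1, ht.2]
  have hG : ∀ r ∈ Icc s (s + T), HasDerivAt (fun r => Real.exp (κ * r) * (h r - (M + ε / κ)))
      (Real.exp (κ * r) * κ * (h r - (M + ε / κ)) +
        Real.exp (κ * r) * (κ * (h (r - T) - h r) + e r)) r := fun r hr => by
    have h1 : HasDerivAt (fun r => Real.exp (κ * r)) (Real.exp (κ * r) * κ) r := by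
      simpa using ((hasDerivAt_id r).const_mul κ).exp
    exact h1.fun_mul ((hd r hr).sub_const _)
  have hanti : AntitoneOn (fun r => Real.exp (κ * r) * (h r - (M + ε / κ))) (Icc s (s + T)) := by
    refine antitoneOn_of_deriv_nonpos (convex_Icc _ _)
      (fun r hr => (hG r hr).continuousAt.continuousWithinAt) ?_ ?_
    · exact fun r hr => (hG r (interior_subset hr)).differentiableAt.differentiableWithinAt
    · intro r hr
      have hr' := interior_subset hr
      rw [(hG r hr').deriv]
      have h1 := hM (r - T) ⟨by linarith [hr'.1], by linarith [hr'.2]⟩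
      have h2 := he r hr'
      have h3 : Real.exp (κ * r) * κ * (h r - (M + ε / κ)) +
          Real.exp (κ * r) * (κ * (h (r - T) - h r) + e r) =
          -(Real.exp (κ * r) * (κ * (M - h (r - T)) + (ε - e r))) := by
        field_simp
        ring
      rw [h3, neg_nonpos]
      refine mul_nonneg (Real.exp_pos _).le (add_nonneg (mul_nonneg hκ.le ?_) ?_) <;> linarith
  have h1 := hanti (left_mem_Icc.2 (by linarith)) ht ht.1
  simp only at h1
  have hs : h s ≤ M := hM s ⟨by linarith, le_rfl⟩
  have hεκ : 0 ≤ ε / κ := by positivity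
  have h2 : h t - (M + ε / κ) ≤ Real.exp (-κ * (t - s)) * (h s - (M + ε / κ)) := by
    have h3 : Real.exp (-κ * (t - s)) = Real.exp (κ * s) / Real.exp (κ * t) := by
      rw [← Real.exp_sub]; congr 1; ring
    rw [h3, div_mul_eq_mul_div, le_div_iff₀ (Real.exp_pos _)]
    linarith
  have h4 : Real.exp (-κ * T) ≤ Real.exp (-κ * (t - s)) := Real.exp_le_exp.2 (by
    nlinarith [ht.2])
  have h5 : 0 < Real.exp (-κ * T) := Real.exp_pos _
  nlinarith [mul_le_mul_of_nonneg_right h4 (show 0 ≤ M + ε / κ - h s by linarith),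
    mul_nonneg h5.le hεκ]

/-- The oscillation of a solution of a delay equation over windows of length `T` contracts. -/
theorem delay_oscillation {κ T ε s N M : ℝ} (hκ : 0 < κ) (hε : 0 ≤ ε) {h e : ℝ → ℝ}
    (hd : ∀ t ∈ Icc s (s + T), HasDerivAt h (κ * (h (t - T) - h t) + e t) t)
    (he : ∀ t ∈ Icc s (s + T), |e t| ≤ ε) (hNM : ∀ t ∈ Icc (s - T) s, N ≤ h t ∧ h t ≤ M) :
    ∃ N' M', M' - N' = (1 - Real.exp (-κ * T)) * (M - N) + 2 * (ε / κ) ∧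
      ∀ t ∈ Icc s (s + T), N' ≤ h t ∧ h t ≤ M' := by
  have h1 := delay_le hκ hε hd (fun t ht => (abs_le.1 (he t ht)).2) fun t ht => (hNM t ht).2
  have h2 := delay_le (h := fun t => -h t) (e := fun t => -e t) (M := -N) hκ hε
    (fun t ht => (hd t ht).fun_neg.congr_deriv (by ring))
    (fun t ht => by linarith [(abs_le.1 (he t ht)).1]) fun t ht => neg_le_neg (hNM t ht).1
  refine ⟨N + Real.exp (-κ * T) * (h s - N) - ε / κ, M - Real.exp (-κ * T) * (M - h s) + ε / κ,
    by ring, fun t ht => ⟨?_, h1 t ht⟩⟩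
  have h3 := h2 t ht
  linarith

theorem delay_oscillation_small {κ T t₀ : ℝ} (hκ : 0 < κ) (hT : 0 < T) {h e : ℝ → ℝ}
    (hc : Continuous h)
    (hd : ∀ t, t₀ ≤ t → HasDerivAt h (κ * (h (t - T) - h t) + e t) t)
    (he : Tendsto e atTop (𝓝 0)) {η : ℝ} (hη : 0 < η) :
    ∃ t₁, ∀ t, t₁ ≤ t → ∀ s ∈ Icc (t - T) t, |h s - h t| ≤ η := by
  set δ := Real.exp (-κ * T) with hδ
  have hδ0 : 0 < δ := Real.exp_pos _
  have hδ1 : δ < 1 := Real.exp_lt_one_iff.mpr (by nlinarith)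
  set ε := η * κ * δ / 4 with hε
  have hε0 : 0 < ε := by positivity
  obtain ⟨t₂, ht₂⟩ : ∃ t₂, ∀ t, t₂ ≤ t → |e t| ≤ ε := by
    have := (Metric.tendsto_nhds.1 he ε hε0)
    obtain ⟨t₂, h2⟩ := eventually_atTop.1 this
    exact ⟨t₂, fun t ht => by simpa using (h2 t ht).le⟩
  set τ := max t₀ t₂ with hτ
  obtain ⟨K, hK⟩ := (isCompact_Icc (a := τ - T) (b := τ + T)).exists_bound_of_continuousOn
    hc.continuousOn
  have key : ∀ n : ℕ, ∀ t ∈ Icc (τ + n * T) (τ + (n + 1) * T), ∃ N M,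
      M - N ≤ (1 - δ) ^ n * (2 * K) + η / 2 ∧ ∀ s ∈ Icc (t - T) t, N ≤ h s ∧ h s ≤ M := by
    intro n
    induction n with
    | zero =>
      intro t ht
      simp only [Nat.cast_zero, zero_mul, add_zero, zero_add, one_mul] at ht
      refine ⟨-K, K, by rw [pow_zero]; linarith, fun s hs => abs_le.1 (hK s ⟨?_, ?_⟩)⟩
      · linarith [ht.1, hs.1]
      · linarith [ht.2, hs.2]
    | succ n ih =>
      intro t ht
      push_cast at ht
      have hnT : 0 ≤ (n : ℝ) * T := by positivity
      have ht1 : t - T ∈ Icc (τ + n * T) (τ + (n + 1) * T) := ⟨by linarith [ht.1], by linarith [ht.2]⟩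
      obtain ⟨N, M, hNM, hw⟩ := ih (t - T) ht1
      have hle : ∀ r ∈ Icc (t - T) (t - T + T), τ ≤ r := fun r hr => by linarith [hr.1, ht1.1]
      obtain ⟨N', M', h1, h2⟩ := delay_oscillation hκ hε0.le
        (fun r hr => hd r ((le_max_left _ _).trans (hle r hr)))
        (fun r hr => ht₂ r ((le_max_right _ _).trans (hle r hr))) hw
      refine ⟨N', M', ?_, fun s hs => h2 s (by rwa [sub_add_cancel])⟩
      rw [h1, ← hδ, pow_succ]
      have h3 : 2 * (ε / κ) = η * δ / 2 := by rw [hε]; field_simp; norm_num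
      rw [h3]
      nlinarith [mul_le_mul_of_nonneg_left hNM (show 0 ≤ 1 - δ by linarith)]
  have hlim : Tendsto (fun n : ℕ => (1 - δ) ^ n * (2 * K)) atTop (𝓝 (0 * (2 * K))) :=
    (tendsto_pow_atTop_nhds_zero_of_lt_one (by linarith) (by linarith)).mul_const _
  rw [zero_mul] at hlim
  obtain ⟨n₁, hn₁⟩ := eventually_atTop.1 (hlim.eventually (gt_mem_nhds (half_pos hη)))
  refine ⟨τ + n₁ * T, fun t ht s hs => ?_⟩
  have hx : 0 ≤ (t - τ) / T := div_nonneg (by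
    have : 0 ≤ (n₁ : ℝ) * T := by positivity
    linarith) hT.le
  have hn : n₁ ≤ ⌊(t - τ) / T⌋₊ := Nat.le_floor (by rw [le_div_iff₀ hT]; linarith)
  have hf1 := Nat.floor_le hx
  have hf2 := Nat.lt_floor_add_one ((t - τ) / T)
  rw [le_div_iff₀ hT] at hf1
  rw [div_lt_iff₀ hT] at hf2
  obtain ⟨N, M, h1, h2⟩ := key ⌊(t - τ) / T⌋₊ t ⟨by linarith, by linarith⟩
  have h3 := hn₁ _ hn
  have h4 := h2 s hs
  have h5 := h2 t ⟨by linarith, le_rfl⟩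
  rw [abs_le]
  constructor <;> linarith

/-- Solutions of the renewal equation with convergent forcing converge. -/
theorem tendsto_renewal {A c T t₀ F : ℝ} (hA : 0 < A) (hc : 0 < c) (hT : 0 < T) {β f : ℝ → ℝ}
    (hβ : Continuous β) (h : ∀ t, t₀ ≤ t → A * β t + c * ∫ s in (t - T)..t, β s = f t)
    (hf : Tendsto f atTop (𝓝 F)) : Tendsto β atTop (𝓝 (F / (A + c * T))) := by
  set H : ℝ → ℝ := fun t => c * ∫ s in (t - T)..t, β s with hH
  have hi : ∀ x y, IntervalIntegrable β volume x y := fun x y => hβ.intervalIntegrable x y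
  have hHd : ∀ t, HasDerivAt H (c * (β t - β (t - T))) t := fun t => by
    have he : ∀ t, ∫ s in (t - T)..t, β s
        = (∫ s in (0 : ℝ)..t, β s) - ∫ s in (0 : ℝ)..(t - T), β s := fun t =>
      (intervalIntegral.integral_interval_sub_left (hi _ _) (hi _ _)).symm
    have h1 : ∀ t, HasDerivAt (fun t => ∫ s in (0 : ℝ)..t, β s) (β t) t := fun t =>
      (hβ.integral_hasStrictDerivAt 0 t).hasDerivAt
    simp_rw [hH, he]
    exact ((h1 t).fun_sub ((h1 (t - T)).comp_sub_const t T)).const_mul c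
  have hHc : Continuous H := continuous_iff_continuousAt.2 fun t => (hHd t).continuousAt
  have hHβ : ∀ t, t₀ ≤ t → A * β t = f t - H t := fun t ht => by
    have := h t ht
    simp only [hH]
    linarith
  have hκ : 0 < c / A := div_pos hc hA
  set e : ℝ → ℝ := fun t => c / A * (f t - f (t - T)) with he
  have hHd' : ∀ t, t₀ + T ≤ t → HasDerivAt H (c / A * (H (t - T) - H t) + e t) t := fun t ht => by
    refine (hHd t).congr_deriv ?_
    have h1 := hHβ t (by linarith)
    have h2 := hHβ (t - T) (by linarith)
    simp only [he]
    field_simp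
    linear_combination h1 - h2
  have het : Tendsto e atTop (𝓝 0) := by
    have h1 : Tendsto (fun t : ℝ => t - T) atTop atTop := tendsto_atTop_add_const_right _ _ tendsto_id
    have h2 := (hf.sub (hf.comp h1)).const_mul (c / A)
    simpa using h2
  have hAT : 0 < A + c * T := by positivity
  have hHlim : Tendsto H atTop (𝓝 (c * T * F / (A + c * T))) := by
    rw [Metric.tendsto_nhds]
    intro η hη
    set η' := η * (A + c * T) / (4 * (c * T)) with hη'
    have hη'0 : 0 < η' := by positivity
    obtain ⟨t₁, ht₁⟩ := delay_oscillation_small hκ hT hHc hHd' het hη'0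
    obtain ⟨t₂, ht₂⟩ := eventually_atTop.1 (Metric.tendsto_nhds.1 hf η' hη'0)
    filter_upwards [eventually_ge_atTop (max t₁ (max (t₀ + T) (t₂ + T)))] with t ht
    have ht1 := (le_max_left _ _).trans ht
    have ht2 := ((le_max_left _ _).trans (le_max_right _ _)).trans ht
    have ht3 := ((le_max_right _ _).trans (le_max_right _ _)).trans ht
    have h1 : |(∫ s in (t - T)..t, (A * β s - (F - H t)))| ≤ 2 * η' * |t - (t - T)| := by
      rw [← Real.norm_eq_abs (∫ s in (t - T)..t, _)]
      refine intervalIntegral.norm_integral_le_of_norm_le_const fun s hs => ?_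
      rw [uIoc_of_le (by linarith)] at hs
      rw [hHβ s (by linarith [hs.1])]
      have h2 := ht₁ t ht1 s ⟨hs.1.le, hs.2⟩
      have h3 := ht₂ s (by linarith [hs.1])
      rw [Real.dist_eq] at h3
      rw [Real.norm_eq_abs]
      rw [abs_le] at h2 ⊢
      rw [abs_lt] at h3
      constructor <;> linarith [h2.1, h2.2, h3.1, h3.2]
    rw [intervalIntegral.integral_sub ((hi _ _).const_mul A) intervalIntegrable_const,
      intervalIntegral.integral_const_mul, intervalIntegral.integral_const, smul_eq_mul,
      show t - (t - T) = T by ring, abs_of_pos hT] at h1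
    have h4 : H t - c * T * F / (A + c * T) =
        c / (A + c * T) * (A * (∫ s in (t - T)..t, β s) - T * (F - H t)) := by
      simp only [hH]
      field_simp
      ring
    rw [Real.dist_eq, h4, abs_mul, abs_of_pos (div_pos hc hAT)]
    calc _ ≤ c / (A + c * T) * (2 * η' * T) := mul_le_mul_of_nonneg_left h1 (by positivity)
      _ = η / 2 := by rw [hη']; field_simp; norm_num
      _ < η := by linarith
  have h5 := (hf.sub hHlim).div_const A
  have h6 : (F - c * T * F / (A + c * T)) / A = F / (A + c * T) := by field_simp; ring
  rw [h6] at h5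
  refine h5.congr' ?_
  filter_upwards [eventually_ge_atTop t₀] with t ht
  rw [← hHβ t ht]
  field_simp

/-- Translations are continuous in `L¹(ℝ)`. -/
theorem tendsto_integral_abs_translate_sub {β : ℝ → ℝ} (hβ : Integrable β) (s : ℝ) :
    Tendsto (fun t => ∫ r, |β (t + r) - β (s + r)|) (𝓝 s) (𝓝 0) := by
  set g : Lp ℝ 1 (volume : Measure ℝ) := hβ.toL1 β with hg
  have : Fact ((1 : ENNReal) ≠ ⊤) := ⟨ENNReal.one_ne_top⟩
  have hc : Continuous fun t : ℝ => (DomAddAct.mk t +ᵥ g : Lp ℝ 1 (volume : Measure ℝ)) := by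
    have h1 : Continuous fun t : ℝ => DomAddAct.mk t := DomAddAct.continuous_mk
    exact h1.vadd continuous_const
  have h1 := tendsto_iff_norm_sub_tendsto_zero.1 (hc.tendsto s)
  refine h1.congr fun t => ?_
  rw [L1.norm_eq_integral_norm]
  refine integral_congr_ae ?_
  have h2 : ∀ t : ℝ, (DomAddAct.mk t +ᵥ g : Lp ℝ 1 (volume : Measure ℝ)) =ᵐ[volume]
      fun r => β (t + r) := fun t => by
    refine (DomAddAct.vadd_Lp_ae_eq _ _).trans ?_
    exact (measurePreserving_add_left volume t).quasiMeasurePreserving.ae_eq_comp hβ.coeFn_toL1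
  filter_upwards [Lp.coeFn_sub (DomAddAct.mk t +ᵥ g : Lp ℝ 1 (volume : Measure ℝ))
    (DomAddAct.mk s +ᵥ g), h2 t, h2 s] with r h3 h4 h5
  rw [h3, Pi.sub_apply, h4, h5, Real.norm_eq_abs]

/-- The travel time from age `0` to age `x` at speed `c / f`. -/
def travelTime (f : ℝ → ℝ) (c x : ℝ) : ℝ := (∫ y in (0 : ℝ)..x, f y) / c

section

variable {L c : ℝ} {f : ℝ → ℝ}

@[simp] theorem travelTime_zero : travelTime f c 0 = 0 := by simp [travelTime]

theorem IsProfile.continuousOn (hf : IsProfile L f) (hL : 0 < L) : ContinuousOn f (Icc 0 L) := by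
  have := hf.ac.continuousOn
  rwa [uIcc_of_le hL.le] at this

theorem IsProfile.nonneg (hf : IsProfile L f) {x : ℝ} (hx : x ∈ Icc 0 L) : 0 ≤ f x := by
  rcases hx.2.eq_or_lt with h | h
  · rw [h, hf.vanish]
  · exact (hf.pos x ⟨hx.1, h⟩).le

theorem IsProfile.hasDerivAt_travelTime (hf : IsProfile L f) (hL : 0 < L) {x : ℝ}
    (hx : x ∈ Ioo 0 L) : HasDerivAt (travelTime f c) (f x / c) x := by
  have hc := hf.continuousOn hL
  have hn : Icc 0 L ∈ 𝓝 x := Icc_mem_nhds hx.1 hx.2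
  refine HasDerivAt.div_const ?_ c
  refine intervalIntegral.integral_hasDerivAt_right ?_ ?_ (hc.continuousAt hn)
  · refine (hc.mono ?_).intervalIntegrable
    rw [uIcc_of_le hx.1.le]
    exact Icc_subset_Icc_right hx.2.le
  · exact hc.stronglyMeasurableAtFilter_nhdsWithin measurableSet_Icc x |>.filter_mono
      (by rw [nhdsWithin_eq_nhds.2 hn])

theorem IsProfile.continuousOn_travelTime (hf : IsProfile L f) (hL : 0 < L) :
    ContinuousOn (travelTime f c) (Icc 0 L) := by
  have h := intervalIntegral.continuousOn_primitive_interval (μ := volume) (f := f) (a := 0)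
    (b := L) (by rw [uIcc_of_le hL.le]; exact (hf.continuousOn hL).integrableOn_Icc)
  rw [uIcc_of_le hL.le] at h
  exact h.div_const c

theorem IsProfile.strictMonoOn_travelTime (hf : IsProfile L f) (hL : 0 < L) (hc : 0 < c) :
    StrictMonoOn (travelTime f c) (Icc 0 L) := by
  refine strictMonoOn_of_deriv_pos (convex_Icc 0 L) (hf.continuousOn_travelTime hL) fun x hx => ?_
  rw [interior_Icc] at hx
  rw [(hf.hasDerivAt_travelTime hL hx).deriv]
  exact div_pos (hf.pos x ⟨hx.1.le, hx.2⟩) hc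

theorem IsProfile.travelTime_mem (hf : IsProfile L f) (hL : 0 < L) (hc : 0 < c) {x : ℝ}
    (hx : x ∈ Icc 0 L) : travelTime f c x ∈ Icc 0 (travelTime f c L) := by
  have hm := (hf.strictMonoOn_travelTime hL hc).monotoneOn
  refine ⟨?_, hm hx (right_mem_Icc.2 hL.le) hx.2⟩
  have := hm (left_mem_Icc.2 hL.le) hx hx.1
  rwa [travelTime_zero] at this

theorem IsProfile.integrable_comp_travelTime_iff (hf : IsProfile L f) (hL : 0 < L) (hc : 0 < c)
    (g : ℝ → ℝ) : Integrable (fun x => f x * g (travelTime f c x)) (ageMeasure L) ↔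
      IntegrableOn g (Icc 0 (travelTime f c L)) := by
  have h := integrableOn_Icc_deriv_smul_iff_of_deriv_nonneg (g := g)
    (hf.continuousOn_travelTime hL (c := c)) (fun x hx => hf.hasDerivAt_travelTime hL hx)
    (fun x hx => (div_pos (hf.pos x ⟨hx.1.le, hx.2⟩) hc).le) hL.le
  rw [travelTime_zero] at h
  rw [← h, integrableOn_Icc_iff_integrableOn_Ioc]
  constructor
  · intro h1
    refine (h1.const_mul c⁻¹).congr (Eventually.of_forall fun x => ?_)
    simp only [smul_eq_mul]
    ring
  · intro h1
    refine (h1.const_mul c).congr (Eventually.of_forall fun x => ?_)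
    simp only [smul_eq_mul]
    field_simp

theorem IsProfile.integral_comp_travelTime (hf : IsProfile L f) (hL : 0 < L) (hc : 0 < c)
    (g : ℝ → ℝ) {x : ℝ} (hx : x ∈ Icc 0 L) :
    ∫ y in (0 : ℝ)..x, f y * g (travelTime f c y) = c * ∫ r in (0 : ℝ)..(travelTime f c x), g r := by
  have hm := hf.travelTime_mem hL hc hx
  have h := integral_Icc_deriv_smul_of_deriv_nonneg (g := g)
    ((hf.continuousOn_travelTime hL (c := c)).mono (Icc_subset_Icc_right hx.2))
    (fun y hy => hf.hasDerivAt_travelTime hL ⟨hy.1, hy.2.trans_le hx.2⟩)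
    (fun y hy => (div_pos (hf.pos y ⟨hy.1.le, hy.2.trans_le hx.2⟩) hc).le) hx.1
  rw [travelTime_zero, integral_Icc_eq_integral_Ioc, integral_Icc_eq_integral_Ioc,
    ← intervalIntegral.integral_of_le hx.1, ← intervalIntegral.integral_of_le hm.1] at h
  rw [← h, ← intervalIntegral.integral_const_mul]
  refine intervalIntegral.integral_congr fun y _ => ?_
  simp only [smul_eq_mul]
  field_simp

/-- Any `φ ∈ L¹(0, L)` is the transport profile at time `0` of some boundary signal. -/
theorem IsProfile.exists_signal (hf : IsProfile L f) (hL : 0 < L) (hc : 0 < c) (φ : AgeL1 L) :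
    ∃ β₀ : ℝ → ℝ, Integrable β₀ ∧ ∀ x ∈ Ioo 0 L, f x * β₀ (-travelTime f c x) = φ x := by
  set G := Function.invFunOn (travelTime f c) (Icc 0 L) with hG
  have hinv : ∀ x ∈ Icc 0 L, G (travelTime f c x) = x := fun x hx =>
    (hf.strictMonoOn_travelTime hL hc).injOn.leftInvOn_invFunOn hx
  set k : ℝ → ℝ := fun r => φ (G r) / f (G r) with hk
  have hfk : ∀ x ∈ Ioo 0 L, f x * k (travelTime f c x) = φ x := fun x hx => by
    have := (hf.pos x ⟨hx.1.le, hx.2⟩).ne'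
    simp only [hk, hinv x ⟨hx.1.le, hx.2.le⟩]
    field_simp
  have hki : IntegrableOn k (Icc 0 (travelTime f c L)) := by
    rw [← hf.integrable_comp_travelTime_iff hL hc]
    refine φ.integrable.congr ?_
    filter_upwards [ae_ageMeasure_mem_Ioo L] with x hx
    exact (hfk x hx).symm
  refine ⟨fun s => (Icc 0 (travelTime f c L)).indicator k (-s),
    ((integrable_indicator_iff measurableSet_Icc).2 hki).comp_neg, fun x hx => ?_⟩
  simp only [neg_neg]
  rw [indicator_of_mem (hf.travelTime_mem hL hc ⟨hx.1.le, hx.2.le⟩), hfk x hx]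

/-- The state at time `t` of the transport equation with boundary signal `β`. -/
def transportState (f : ℝ → ℝ) (c : ℝ) (β : ℝ → ℝ) (L t : ℝ) : AgeL1 L :=
  open Classical in
  if h : Integrable (fun x => f x * β (t - travelTime f c x)) (ageMeasure L) then h.toL1 _ else 0

variable {β : ℝ → ℝ}

theorem IsProfile.integrable_transport (hf : IsProfile L f) (hL : 0 < L) (hc : 0 < c)
    (hβ : ∀ x y, IntervalIntegrable β volume x y) (t : ℝ) :
    Integrable (fun x => f x * β (t - travelTime f c x)) (ageMeasure L) := by
  refine (hf.integrable_comp_travelTime_iff hL hc fun r => β (t - r)).2 ?_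
  have h := (hβ (t - 0) (t - travelTime f c L)).comp_sub_left t
  rw [sub_sub_cancel, sub_sub_cancel, intervalIntegrable_iff_integrableOn_Icc_of_le
    (hf.travelTime_mem hL hc (right_mem_Icc.2 hL.le)).1] at h
  exact h

theorem IsProfile.coeFn_transportState (hf : IsProfile L f) (hL : 0 < L) (hc : 0 < c)
    (hβ : ∀ x y, IntervalIntegrable β volume x y) (t : ℝ) :
    transportState f c β L t =ᵐ[ageMeasure L] fun x => f x * β (t - travelTime f c x) := by
  have h := hf.integrable_transport hL hc hβ t
  rw [transportState, dif_pos h]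
  exact h.coeFn_toL1

theorem IsProfile.primitive_transportState (hf : IsProfile L f) (hL : 0 < L) (hc : 0 < c)
    (hβ : ∀ x y, IntervalIntegrable β volume x y) (t : ℝ) {x : ℝ} (hx : x ∈ Icc 0 L) :
    primitive L x (transportState f c β L t) = c * ∫ s in (t - travelTime f c x)..t, β s := by
  have h1 : ∫ y in (0 : ℝ)..x, transportState f c β L t y
      = ∫ y in (0 : ℝ)..x, f y * β (t - travelTime f c y) := by
    refine intervalIntegral.integral_congr_ae ?_
    filter_upwards [(ae_restrict_iff' measurableSet_Ioc).1 (hf.coeFn_transportState hL hc hβ t)]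
      with y hy hy'
    rw [uIoc_of_le hx.1] at hy'
    exact hy ⟨hy'.1, hy'.2.trans hx.2⟩
  rw [primitive_eq hx, h1, hf.integral_comp_travelTime hL hc (fun r => β (t - r)) hx,
    intervalIntegral.integral_comp_sub_left, sub_zero]

theorem IsProfile.continuous_transportState (hf : IsProfile L f) (hL : 0 < L) (hc : 0 < c)
    (hβ : ∀ x y, IntervalIntegrable β volume x y) : Continuous (transportState f c β L) := by
  rw [continuous_iff_continuousAt]
  intro s
  set T := travelTime f c L with hT
  have hT0 : 0 ≤ T := (hf.travelTime_mem hL hc (right_mem_Icc.2 hL.le)).1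
  set I := Icc (s - 1 - T) (s + 1) with hI
  set β' := I.indicator β with hβ'
  have hβ'i : Integrable β' := by
    rw [hβ', integrable_indicator_iff measurableSet_Icc,
      ← intervalIntegrable_iff_integrableOn_Icc_of_le (by linarith)]
    exact hβ _ _
  have h1 := (tendsto_integral_abs_translate_sub hβ'i s).const_mul c
  rw [mul_zero] at h1
  rw [ContinuousAt, tendsto_iff_norm_sub_tendsto_zero]
  refine squeeze_zero' (Eventually.of_forall fun _ => norm_nonneg _) ?_ h1
  filter_upwards [Ioo_mem_nhds (sub_one_lt s) (lt_add_one s)] with t ht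
  have hmem : ∀ r ∈ Icc 0 T, t - r ∈ I ∧ s - r ∈ I := fun r hr =>
    ⟨⟨by linarith [ht.1, hr.2], by linarith [ht.2, hr.1]⟩, ⟨by linarith [hr.2], by linarith [hr.1]⟩⟩
  have hi : Integrable fun r => |β' (t + r) - β' (s + r)| :=
    ((hβ'i.comp_add_left t).sub (hβ'i.comp_add_left s)).abs
  have h2 : ‖transportState f c β L t - transportState f c β L s‖
      = ∫ x in (0 : ℝ)..L, f x * |β' (t - travelTime f c x) - β' (s - travelTime f c x)| := by
    rw [AgeL1.norm_eq, ← integral_ageMeasure hL.le]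
    refine integral_congr_ae ?_
    filter_upwards [Lp.coeFn_sub (transportState f c β L t) (transportState f c β L s),
      hf.coeFn_transportState hL hc hβ t, hf.coeFn_transportState hL hc hβ s,
      ae_ageMeasure_mem_Ioo L] with x h3 h4 h5 hx
    have hx' : x ∈ Icc 0 L := ⟨hx.1.le, hx.2.le⟩
    obtain ⟨m1, m2⟩ := hmem _ (hf.travelTime_mem hL hc hx')
    rw [h3, Pi.sub_apply, h4, h5, ← mul_sub, norm_mul, Real.norm_of_nonneg (hf.nonneg hx'),
      Real.norm_eq_abs, hβ', indicator_of_mem m1, indicator_of_mem m2]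
  rw [h2, hf.integral_comp_travelTime hL hc (fun r => |β' (t - r) - β' (s - r)|)
    (right_mem_Icc.2 hL.le), intervalIntegral.integral_of_le hT0]
  refine mul_le_mul_of_nonneg_left ?_ hc.le
  have h3 : ∫ r, |β' (t + r) - β' (s + r)| = ∫ r, |β' (t - r) - β' (s - r)| := by
    rw [← integral_neg_eq_self]
    rfl
  have hi' : Integrable fun r => |β' (t - r) - β' (s - r)| := hi.comp_neg
  rw [h3]
  exact setIntegral_le_integral hi' (Eventually.of_forall fun _ => abs_nonneg _)

/-- The transport profile solves the integrated transport equation. -/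
theorem IsProfile.integral_transportState (hf : IsProfile L f) (hL : 0 < L) (hc : 0 < c)
    (hβ : ∀ x y, IntervalIntegrable β volume x y) {e : AgeL1 L} (he : e =ᵐ[ageMeasure L] f)
    (t : ℝ) : ∫ s in (0 : ℝ)..t, transportState f c β L s = (∫ s in (0 : ℝ)..t, β s) • e -
      c⁻¹ • volterra e (transportState f c β L t - transportState f c β L 0) := by
  set B : ℝ → ℝ := fun t => ∫ s in (0 : ℝ)..t, β s with hB
  have hBc : Continuous B := intervalIntegral.continuous_primitive hβ 0
  have hBs : ∀ x y, ∫ s in x..y, β s = B y - B x := fun x y =>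
    (intervalIntegral.integral_interval_sub_left (hβ _ _) (hβ _ _)).symm
  have hBi : ∀ x y, IntervalIntegrable B volume x y := fun x y => hBc.intervalIntegrable x y
  have hcont := hf.continuous_transportState hL hc hβ
  refine AgeL1.ext_primitive hL.le fun x hx => ?_
  set θ := travelTime f c x with hθ
  have h1 : primitive L x (∫ s in (0 : ℝ)..t, transportState f c β L s)
      = ∫ s in (0 : ℝ)..t, c * (B s - B (s - θ)) := by
    rw [← (primitive L x).intervalIntegral_comp_comm (hcont.intervalIntegrable _ _)]
    refine intervalIntegral.integral_congr fun s _ => ?_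
    rw [hf.primitive_transportState hL hc hβ s hx, hBs]
  have h2 : primitive L x (B t • e -
      c⁻¹ • volterra e (transportState f c β L t - transportState f c β L 0))
      = ∫ y in (0 : ℝ)..x, f y * (B (t - travelTime f c y) - B (-travelTime f c y)) := by
    rw [primitive_eq hx]
    refine intervalIntegral.integral_congr_ae ?_
    filter_upwards [(ae_restrict_iff' measurableSet_Ioc).1 (coeFn_smul_sub_smul_volterra e
      (transportState f c β L t - transportState f c β L 0) he (B t) c⁻¹)] with y hy hy'
    rw [uIoc_of_le hx.1] at hy'
    have hyL : y ∈ Icc 0 L := ⟨hy'.1.le, hy'.2.trans hx.2⟩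
    rw [hy ⟨hy'.1, hy'.2.trans hx.2⟩, map_sub, hf.primitive_transportState hL hc hβ t hyL,
      hf.primitive_transportState hL hc hβ 0 hyL, hBs, hBs]
    have hB0 : B 0 = 0 := by simp [hB]
    rw [hB0, zero_sub (travelTime f c y)]
    field_simp
    ring
  rw [h1, h2, hf.integral_comp_travelTime hL hc (fun r => B (t - r) - B (-r)) hx,
    intervalIntegral.integral_const_mul]
  congr 1
  have i1 : IntervalIntegrable (fun s => B (s - θ)) volume 0 t :=
    (hBc.comp (continuous_id.sub continuous_const)).intervalIntegrable _ _
  have i2 : IntervalIntegrable (fun s => B (t - s)) volume 0 θ :=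
    (hBc.comp (continuous_const.sub continuous_id)).intervalIntegrable _ _
  have i3 : IntervalIntegrable (fun s => B (-s)) volume 0 θ :=
    (hBc.comp continuous_neg).intervalIntegrable _ _
  have hJ : ∀ x y, ∫ s in x..y, B s = (∫ s in (0 : ℝ)..y, B s) - ∫ s in (0 : ℝ)..x, B s :=
    fun x y => (intervalIntegral.integral_interval_sub_left (hBi _ _) (hBi _ _)).symm
  rw [intervalIntegral.integral_sub (hBi _ _) i1, intervalIntegral.integral_sub i2 i3,
    intervalIntegral.integral_comp_sub_right, intervalIntegral.integral_comp_sub_left,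
    intervalIntegral.integral_comp_neg, hJ (0 - θ), hJ (t - θ), hJ (-θ)]
  simp only [zero_sub, sub_zero, neg_zero, intervalIntegral.integral_same]
  ring

theorem IsProfile.tendsto_transportState (hf : IsProfile L f) (hL : 0 < L) (hc : 0 < c)
    (hβ : ∀ x y, IntervalIntegrable β volume x y) {e : AgeL1 L} (he : e =ᵐ[ageMeasure L] f)
    {k : ℝ} (hk : Tendsto β atTop (𝓝 k)) :
    Tendsto (transportState f c β L) atTop (𝓝 (k • e)) := by
  rw [Metric.tendsto_nhds]
  intro ε hε
  have hY := hf.integral_pos hL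
  set Y := ∫ x in (0 : ℝ)..L, f x with hYd
  obtain ⟨t₁, ht₁⟩ := eventually_atTop.1 (Metric.tendsto_nhds.1 hk (ε / (2 * Y)) (by positivity))
  filter_upwards [eventually_ge_atTop (t₁ + travelTime f c L)] with t ht
  rw [dist_eq_norm, AgeL1.norm_eq]
  have h1 : ∫ x, ‖(transportState f c β L t - k • e : AgeL1 L) x‖ ∂(ageMeasure L)
      ≤ ∫ x, ε / (2 * Y) * f x ∂(ageMeasure L) := by
    refine integral_mono_ae (AgeL1.integrable _).norm ((hf.integrable hL).const_mul _) ?_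
    filter_upwards [Lp.coeFn_sub (transportState f c β L t) (k • e), Lp.coeFn_smul k e, he,
      hf.coeFn_transportState hL hc hβ t, ae_ageMeasure_mem_Ioo L] with x h2 h3 h4 h5 hx
    have hx' : x ∈ Icc 0 L := ⟨hx.1.le, hx.2.le⟩
    have h6 := ht₁ (t - travelTime f c x) (by linarith [(hf.travelTime_mem hL hc hx').2])
    rw [Real.dist_eq] at h6
    rw [h2, Pi.sub_apply, h3, Pi.smul_apply, h4, h5, smul_eq_mul, mul_comm k, ← mul_sub, norm_mul,
      Real.norm_of_nonneg (hf.nonneg hx'), Real.norm_eq_abs, mul_comm]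
    exact mul_le_mul_of_nonneg_right h6.le (hf.nonneg hx')
  rw [integral_const_mul, integral_ageMeasure hL.le f, ← hYd] at h1
  have h7 : ε / (2 * Y) * Y = ε / 2 := by field_simp
  linarith

end

section

variable {L a c₁ c₂ : ℝ} {f₁ f₂ : ℝ → ℝ} {e₁ e₂ : AgeL1 L}

theorem continuous_comp_max_zero {β : ℝ → ℝ} (hβ : ContinuousOn β (Ici 0)) :
    Continuous fun t : ℝ => β (max t 0) :=
  hβ.comp_continuous (by fun_prop) fun t => le_max_right t 0

theorem tendsto_renewal_of_continuousOn {A c T F : ℝ} (hA : 0 < A) (hc : 0 < c) (hT : 0 < T)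
    {β f : ℝ → ℝ} (hβ : ContinuousOn β (Ici 0))
    (h : ∀ t, 0 ≤ t → A * β t + c * ∫ s in (t - T)..t, β s = f t)
    (hf : Tendsto f atTop (𝓝 F)) : Tendsto β atTop (𝓝 (F / (A + c * T))) := by
  have h1 : Tendsto (fun t => β (max t 0)) atTop (𝓝 (F / (A + c * T))) := by
    refine tendsto_renewal (t₀ := T) hA hc hT (continuous_comp_max_zero hβ) (fun t ht => ?_) hf
    rw [← h t (hT.le.trans ht), max_eq_left (hT.le.trans ht)]
    congr 2
    refine intervalIntegral.integral_congr fun s hs => ?_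
    rw [uIcc_of_le (by linarith)] at hs
    rw [max_eq_left (by linarith [hs.1])]
  refine h1.congr' ?_
  filter_upwards [eventually_ge_atTop 0] with t ht
  rw [max_eq_left ht]

/-- Existence and asymptotics of the mild solution of the autonomous system. -/
theorem exists_mild (hL : 0 < L) (ha : 0 < a) (hc₁ : 0 < c₁) (hc₂ : 0 < c₂)
    (hf₁ : IsProfile L f₁) (hf₂ : IsProfile L f₂) (he₁ : e₁ =ᵐ[ageMeasure L] f₁)
    (he₂ : e₂ =ᵐ[ageMeasure L] f₂) (φ : RepairState L) :
    ∃ P : ℝ → RepairState L, Continuous P ∧ P 0 = φ ∧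
      (∀ t, 0 ≤ t → graphMap a (a + ∫ x in (0 : ℝ)..L, f₁ x) c₁ c₂ e₁ e₂
        (∫ s in (0 : ℝ)..t, P s, P t - P 0) = 0) ∧
      Tendsto P atTop (𝓝 ((totalMass L φ /
        (a + (∫ x in (0 : ℝ)..L, f₁ x) + ∫ x in (0 : ℝ)..L, f₂ x)) • (a, e₁, e₂))) := by
  set b := ∫ x in (0 : ℝ)..L, f₁ x with hb
  set d := ∫ x in (0 : ℝ)..L, f₂ x with hd
  set m := totalMass L φ with hm
  have hb0 : 0 < b := hf₁.integral_pos hL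
  have hd0 : 0 < d := hf₂.integral_pos hL
  have hT₁ : c₁ * travelTime f₁ c₁ L = b := by rw [travelTime, ← hb]; field_simp
  have hT₂ : c₂ * travelTime f₂ c₂ L = d := by rw [travelTime, ← hd]; field_simp
  have hT₁0 : 0 < travelTime f₁ c₁ L := div_pos hb0 hc₁
  have hT₂0 : 0 < travelTime f₂ c₂ L := div_pos hd0 hc₂
  have hA : 0 < a + b := add_pos ha hb0
  obtain ⟨γ₂, hγ₂, hγ₂φ⟩ := hf₂.exists_signal hL hc₂ φ.2.2
  obtain ⟨γ₁, hγ₁, hγ₁φ⟩ := hf₁.exists_signal hL hc₁ φ.2.1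
  obtain ⟨β₂, hβ₂0, hβ₂c, ⟨C, γ, hβ₂b⟩, hβ₂i, hβ₂⟩ := exists_renewal hA hc₂ hT₂0 hγ₂
    (f := fun _ => m) continuousOn_const (C := |m|) (γ := 0) (fun t _ => by simp)
  obtain ⟨β₁, hβ₁0, hβ₁c, -, hβ₁i, hβ₁⟩ := exists_renewal ha hc₁ hT₁0 hγ₁
    (f := fun t => (a + b) * β₂ t) (continuousOn_const.mul hβ₂c) (C := (a + b) * C) (γ := γ)
    (fun t ht => by
      rw [abs_mul, abs_of_pos hA, mul_assoc]
      exact mul_le_mul_of_nonneg_left (hβ₂b t ht) hA.le)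
  have hlim₂ : Tendsto β₂ atTop (𝓝 (m / (a + b + d))) := by
    have := tendsto_renewal_of_continuousOn hA hc₂ hT₂0 hβ₂c hβ₂ tendsto_const_nhds
    rwa [hT₂] at this
  have hlim₁ : Tendsto β₁ atTop (𝓝 (m / (a + b + d))) := by
    have := tendsto_renewal_of_continuousOn ha hc₁ hT₁0 hβ₁c hβ₁ (hlim₂.const_mul (a + b))
    rw [hT₁] at this
    convert this using 2
    field_simp
  have hp₁ : ∀ t, primitive L L (transportState f₁ c₁ β₁ L t) =
      c₁ * ∫ s in (t - travelTime f₁ c₁ L)..t, β₁ s := fun t =>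
    hf₁.primitive_transportState hL hc₁ hβ₁i t (right_mem_Icc.2 hL.le)
  have hp₂ : ∀ t, primitive L L (transportState f₂ c₂ β₂ L t) =
      c₂ * ∫ s in (t - travelTime f₂ c₂ L)..t, β₂ s := fun t =>
    hf₂.primitive_transportState hL hc₂ hβ₂i t (right_mem_Icc.2 hL.le)
  set P : ℝ → RepairState L := fun t => (a * β₁ (max t 0), transportState f₁ c₁ β₁ L t,
    transportState f₂ c₂ β₂ L t) with hP
  have hPc : Continuous P := (continuous_const.mul (continuous_comp_max_zero hβ₁c)).prodMk
    ((hf₁.continuous_transportState hL hc₁ hβ₁i).prodMk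
      (hf₂.continuous_transportState hL hc₂ hβ₂i))
  have hz₁ : ∀ t, 0 ≤ t → (P t).1 + primitive L L (P t).2.1 = (a + b) * β₂ t := fun t ht => by
    simp only [hP, hp₁, max_eq_left ht]
    exact hβ₁ t ht
  have hmass : ∀ t, 0 ≤ t → totalMass L (P t) = m := fun t ht => by
    rw [totalMass_apply, hz₁ t ht]
    simp only [hP, hp₂]
    exact hβ₂ t ht
  have hi₁ : (P 0).2.1 = φ.2.1 := by
    refine Lp.ext ?_
    filter_upwards [hf₁.coeFn_transportState hL hc₁ hβ₁i 0, ae_ageMeasure_mem_Ioo L] with x h1 hx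
    have h2 : 0 < travelTime f₁ c₁ x := by
      have := hf₁.strictMonoOn_travelTime hL hc₁ (left_mem_Icc.2 hL.le) ⟨hx.1.le, hx.2.le⟩ hx.1
      rwa [travelTime_zero] at this
    simp only [hP]
    rw [h1, zero_sub, hβ₁0 _ (by linarith), hγ₁φ x hx]
  have hi₂ : (P 0).2.2 = φ.2.2 := by
    refine Lp.ext ?_
    filter_upwards [hf₂.coeFn_transportState hL hc₂ hβ₂i 0, ae_ageMeasure_mem_Ioo L] with x h1 hx
    have h2 : 0 < travelTime f₂ c₂ x := by
      have := hf₂.strictMonoOn_travelTime hL hc₂ (left_mem_Icc.2 hL.le) ⟨hx.1.le, hx.2.le⟩ hx.1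
      rwa [travelTime_zero] at this
    simp only [hP]
    rw [h1, zero_sub, hβ₂0 _ (by linarith), hγ₂φ x hx]
  have hi₀ : (P 0).1 = φ.1 := by
    have h1 := hmass 0 le_rfl
    rw [hm, totalMass_apply, totalMass_apply, hi₁, hi₂] at h1
    linarith
  refine ⟨P, hPc, Prod.ext hi₀ (Prod.ext hi₁ hi₂), fun t ht => ?_, ?_⟩
  · rw [graphMap_eq_zero_iff, fst_intervalIntegral hPc, snd_fst_intervalIntegral hPc,
      snd_snd_intervalIntegral hPc]
    have hq₁ : ∫ s in (0 : ℝ)..t, (P s).1 = a * ∫ s in (0 : ℝ)..t, β₁ s := by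
      rw [← intervalIntegral.integral_const_mul]
      refine intervalIntegral.integral_congr fun s hs => ?_
      rw [uIcc_of_le ht] at hs
      simp only [hP, max_eq_left hs.1]
    have hq₂ : (∫ s in (0 : ℝ)..t, (P s).1) + primitive L L (∫ s in (0 : ℝ)..t, (P s).2.1)
        = (a + b) * ∫ s in (0 : ℝ)..t, β₂ s := by
      have hi : IntervalIntegrable (fun s => primitive L L (P s).2.1) volume 0 t :=
        ((primitive L L).continuous.comp hPc.snd.fst).intervalIntegrable _ _
      rw [← (primitive L L).intervalIntegral_comp_comm (hPc.snd.fst.intervalIntegrable _ _),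
        ← intervalIntegral.integral_add (hPc.fst.intervalIntegrable _ _) hi,
        ← intervalIntegral.integral_const_mul]
      refine intervalIntegral.integral_congr fun s hs => ?_
      rw [uIcc_of_le ht] at hs
      exact hz₁ s hs.1
    refine ⟨?_, ?_, ?_⟩
    · rw [← totalMass_apply, map_sub, hmass t ht, hmass 0 le_rfl, sub_self]
    · rw [hq₁, inv_mul_cancel_left₀ ha.ne']
      exact hf₁.integral_transportState hL hc₁ hβ₁i he₁ t
    · rw [hq₂, inv_mul_cancel_left₀ hA.ne']
      exact hf₂.integral_transportState hL hc₂ hβ₂i he₂ t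
  · have l₀ : Tendsto (fun t => a * β₁ (max t 0)) atTop (𝓝 (m / (a + b + d) * a)) := by
      rw [mul_comm]
      refine (hlim₁.const_mul a).congr' ?_
      filter_upwards [eventually_ge_atTop 0] with t ht
      rw [max_eq_left ht]
    exact l₀.prodMk_nhds ((hf₁.tendsto_transportState hL hc₁ hβ₁i he₁ hlim₁).prodMk_nhds
      (hf₂.tendsto_transportState hL hc₂ hβ₂i he₂ hlim₂))

end

section

variable {tf : ℝ}

theorem switchTime_zero : switchTime tf 0 = 0 := by simp [switchTime]

theorem switchTime_succ (j : ℕ) :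
    switchTime tf (j + 1) = switchTime tf j + 6 * tf / Real.pi ^ 2 / ((j : ℝ) + 1) ^ 2 := by
  rw [switchTime, switchTime, Finset.sum_Icc_succ_top (by omega)]
  push_cast
  ring

theorem switchTime_lt_succ (htf : 0 < tf) (j : ℕ) : switchTime tf j < switchTime tf (j + 1) := by
  rw [switchTime_succ]
  have := Real.pi_pos
  have : 0 < 6 * tf / Real.pi ^ 2 / ((j : ℝ) + 1) ^ 2 := by positivity
  linarith

theorem strictMono_switchTime (htf : 0 < tf) : StrictMono (switchTime tf) :=
  strictMono_nat_of_lt_succ (switchTime_lt_succ htf)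

theorem tendsto_switchTime (tf : ℝ) : Tendsto (switchTime tf) atTop (𝓝 tf) := by
  have h1 := (hasSum_zeta_two.tendsto_sum_nat.comp (tendsto_add_atTop_nat 1)).const_mul
    (6 * tf / Real.pi ^ 2)
  have h2 : 6 * tf / Real.pi ^ 2 * (Real.pi ^ 2 / 6) = tf := by
    have := Real.pi_pos.ne'
    field_simp
  rw [h2] at h1
  refine h1.congr fun j => ?_
  rw [switchTime, Function.comp, Finset.range_eq_Ico, Finset.sum_eq_sum_Ico_succ_bot (by omega)]
  simp only [Nat.cast_zero, ne_eq, OfNat.ofNat_ne_zero, not_false_eq_true, zero_pow, div_zero,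
    zero_add]
  rfl

theorem switchTime_lt (htf : 0 < tf) (j : ℕ) : switchTime tf j < tf :=
  (switchTime_lt_succ htf j).trans_le
    ((strictMono_switchTime htf).monotone.ge_of_tendsto (tendsto_switchTime tf) (j + 1))

theorem switchTime_nonneg (htf : 0 < tf) (j : ℕ) : 0 ≤ switchTime tf j := by
  rw [← switchTime_zero (tf := tf)]
  exact (strictMono_switchTime htf).monotone (Nat.zero_le j)

theorem exists_lt_switchTime {t : ℝ} (ht : t < tf) : ∃ n, t < switchTime tf n :=
  ((tendsto_switchTime tf).eventually (lt_mem_nhds ht)).exists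

theorem exists_mem_Ico_switchTime {t : ℝ} (ht : t ∈ Ico 0 tf) :
    ∃ j, t ∈ Ico (switchTime tf j) (switchTime tf (j + 1)) := by
  have hex := exists_lt_switchTime ht.2
  classical
  have h1 := Nat.find_spec hex
  have h0 : Nat.find hex ≠ 0 := fun h => by
    rw [h, switchTime_zero] at h1
    exact absurd ht.1 (not_le.2 h1)
  obtain ⟨j, hj⟩ := Nat.exists_eq_succ_of_ne_zero h0
  refine ⟨j, ?_, by rwa [hj] at h1⟩
  exact not_lt.1 (Nat.find_min hex (by omega))

/-- The rescaled time: it runs at speed `j + 1` on `[t_j, t_{j+1}]`. -/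
def clock (tf t : ℝ) : ℝ := ∑' j, max (t - switchTime tf j) 0

theorem clock_eq_sum (htf : 0 < tf) {t : ℝ} {n : ℕ} (ht : t ≤ switchTime tf n) :
    clock tf t = ∑ j ∈ Finset.range n, max (t - switchTime tf j) 0 := by
  refine tsum_eq_sum fun j hj => max_eq_right ?_
  rw [Finset.mem_range, not_lt] at hj
  linarith [(strictMono_switchTime htf).monotone hj]

theorem clock_zero (htf : 0 < tf) : clock tf 0 = 0 := by
  rw [clock_eq_sum htf (n := 0) switchTime_zero.ge, Finset.sum_range_zero]

theorem clock_nonneg (t : ℝ) : 0 ≤ clock tf t := tsum_nonneg fun _ => le_max_right _ _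

theorem clock_eq_add (htf : 0 < tf) {j : ℕ} {t : ℝ}
    (ht : t ∈ Icc (switchTime tf j) (switchTime tf (j + 1))) :
    clock tf t = clock tf (switchTime tf j) + ((j : ℝ) + 1) * (t - switchTime tf j) := by
  rw [clock_eq_sum htf ht.2, clock_eq_sum htf (switchTime_lt_succ htf j).le, ← sub_eq_iff_eq_add',
    ← Finset.sum_sub_distrib]
  have h1 : ∀ i ∈ Finset.range (j + 1), max (t - switchTime tf i) 0 -
      max (switchTime tf j - switchTime tf i) 0 = t - switchTime tf j := fun i hi => by
    have h2 := (strictMono_switchTime htf).monotone (Nat.lt_succ_iff.1 (Finset.mem_range.1 hi))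
    rw [max_eq_left (by linarith [ht.1]), max_eq_left (by linarith)]
    ring
  rw [Finset.sum_congr rfl h1, Finset.sum_const, Finset.card_range, nsmul_eq_mul]
  push_cast
  ring

theorem continuousOn_clock (htf : 0 < tf) : ContinuousOn (clock tf) (Iio tf) := by
  intro t ht
  obtain ⟨n, hn⟩ := exists_lt_switchTime ht
  have h1 : Continuous fun t => ∑ j ∈ Finset.range n, max (t - switchTime tf j) 0 := by fun_prop
  refine (h1.continuousAt.congr ?_).continuousWithinAt
  filter_upwards [Iio_mem_nhds hn] with s hs
  exact (clock_eq_sum htf (le_of_lt hs)).symm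

theorem clock_mono (htf : 0 < tf) {s t : ℝ} (hst : s ≤ t) (ht : t < tf) :
    clock tf s ≤ clock tf t := by
  obtain ⟨n, hn⟩ := exists_lt_switchTime ht
  rw [clock_eq_sum htf hn.le, clock_eq_sum htf (hst.trans hn.le)]
  exact Finset.sum_le_sum fun j _ => max_le_max (by linarith) le_rfl

theorem clock_switchTime (htf : 0 < tf) (n : ℕ) : clock tf (switchTime tf n) =
    6 * tf / Real.pi ^ 2 * ∑ i ∈ Finset.range n, 1 / ((i : ℝ) + 1) := by
  induction n with
  | zero => rw [switchTime_zero, clock_zero htf]; simp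
  | succ n ih =>
    rw [clock_eq_add htf (right_mem_Icc.2 (switchTime_lt_succ htf n).le), ih, Finset.sum_range_succ,
      switchTime_succ]
    have : (n : ℝ) + 1 ≠ 0 := by positivity
    field_simp
    ring

theorem tendsto_clock (htf : 0 < tf) : Tendsto (clock tf) (𝓝[<] tf) atTop := by
  have h1 : Tendsto (fun n => clock tf (switchTime tf n)) atTop atTop := by
    simp_rw [clock_switchTime htf]
    have := Real.pi_pos
    exact Tendsto.const_mul_atTop (by positivity) Real.tendsto_sum_range_one_div_nat_succ_atTop
  rw [tendsto_atTop]
  intro K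
  obtain ⟨n, hn⟩ := (h1.eventually_ge_atTop K).exists
  filter_upwards [Ioo_mem_nhdsLT (switchTime_lt htf n)] with t ht
  exact hn.trans (clock_mono htf ht.1.le ht.2)

end

section

variable {L : ℝ} {a A c₁ c₂ : ℝ} {e₁ e₂ : AgeL1 L}

theorem graphMap_inv_smul {w : ℝ} {p v : RepairState L}
    (h : graphMap a A c₁ c₂ e₁ e₂ (p, v) = 0) :
    graphMap a A (c₁ * w) (c₂ * w) e₁ e₂ (w⁻¹ • p, v) = 0 := by
  rw [graphMap_eq_zero_iff] at h ⊢
  obtain ⟨h0, h1, h2⟩ := h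
  refine ⟨h0, ?_, ?_⟩
  · simp only [Prod.smul_fst, Prod.smul_snd]
    rw [h1, smul_sub, smul_smul, smul_smul, smul_eq_mul, mul_inv]
    congr 2 <;> ring
  · simp only [Prod.smul_fst, Prod.smul_snd, map_smul]
    rw [h2, smul_sub, smul_smul, smul_smul, smul_eq_mul, smul_eq_mul, mul_inv]
    congr 2 <;> ring

theorem graphMap_smul_right {w : ℝ} (hw : w ≠ 0) {p v : RepairState L}
    (h : graphMap a A c₁ c₂ e₁ e₂ (p, v) = 0) :
    graphMap a A (c₁ * w) (c₂ * w) e₁ e₂ (p, w • v) = 0 := by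
  have h1 := graphMap_inv_smul (w := w) (p := w • p) (v := w • v) (by
    rw [← Prod.smul_mk, map_smul, h, smul_zero])
  rwa [inv_smul_smul₀ hw] at h1

end

theorem totalMass_eq_stateNorm {L : ℝ} (hL : 0 < L) {φ : RepairState L} (h0 : 0 ≤ φ.1)
    (h1 : 0 ≤ φ.2.1) (h2 : 0 ≤ φ.2.2) : totalMass L φ = stateNorm φ := by
  have key : ∀ v : AgeL1 L, 0 ≤ v → primitive L L v = ‖v‖ := fun v hv => by
    rw [primitive_eq (right_mem_Icc.2 hL.le), v.norm_eq, ← integral_ageMeasure hL.le]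
    refine integral_congr_ae ?_
    filter_upwards [(Lp.coeFn_nonneg v).2 hv] with x hx
    rw [Real.norm_of_nonneg hx]
  rw [totalMass_apply, stateNorm, key _ h1, key _ h2, abs_of_nonneg h0]

end

theorem theorem3p1 (lam1 lam2 L tf : ℝ) (hlam1 : 0 < lam1) (hlam2 : 0 < lam2) (hL : 0 < L)
    (htf : 0 < tf)
    (φ : RepairState L) (hφ₀ : 0 ≤ φ.1) (hφ₁ : 0 ≤ φ.2.1) (hφ₂ : 0 ≤ φ.2.2)
    (hφ : stateNorm φ = 1)
    (ps₀ : ℝ) (ps₁ ps₂ : ℝ → ℝ) (hps : IsDesiredState lam1 lam2 L ps₀ ps₁ ps₂)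
    (α₁ α₂ : ℝ) (hα₁ : 0 < α₁) (hα₂ : 0 < α₂) :
    ∃ p : ℝ → RepairState L,
      -- `p` is the unique solution on `[0, t_f)` of the system under the feedback rates
      IsMildSolution lam1 lam2 L ps₁ ps₂ α₁ α₂ tf φ p ∧
      (∀ q : ℝ → RepairState L, IsMildSolution lam1 lam2 L ps₁ ps₂ α₁ α₂ tf φ q →
        ∀ t ∈ Set.Ico 0 tf, q t = p t) ∧
      -- it is a classical one if the initial state lies in the domain of the operator
      ((∃ v : RepairState L, ClosedLoop lam1 lam2 L ps₁ ps₂ α₁ α₂ 1 φ v) →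
        SolvesClassically lam1 lam2 L ps₁ ps₂ α₁ α₂ tf p) ∧
      -- it is continuous up to `t_f` and reaches the desired state there
      ContinuousOn p (Set.Icc 0 tf) ∧
      (p tf).1 = ps₀ ∧
      (∀ᵐ x ∂(ageMeasure L), (p tf).2.1 x = ps₁ x) ∧
      (∀ᵐ x ∂(ageMeasure L), (p tf).2.2 x = ps₂ x) := by
  have hf₁ := hps.profile₁ hL
  have hf₂ := hps.profile₂ hL
  have ha := hps.ps₀_pos hL hlam1
  set e₁ : AgeL1 L := (hf₁.integrable hL).toL1 ps₁
  set e₂ : AgeL1 L := (hf₂.integrable hL).toL1 ps₂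
  have he₁ : e₁ =ᵐ[ageMeasure L] ps₁ := (hf₁.integrable hL).coeFn_toL1
  have he₂ : e₂ =ᵐ[ageMeasure L] ps₂ := (hf₂.integrable hL).coeFn_toL1
  have hn₁ : 0 ≤ᵐ[ageMeasure L] e₁ := by
    filter_upwards [he₁, ae_ageMeasure_mem_Ioo L] with x h hx
    rw [h]
    exact hf₁.nonneg ⟨hx.1.le, hx.2.le⟩
  have hn₂ : 0 ≤ᵐ[ageMeasure L] e₂ := by
    filter_upwards [he₂, ae_ageMeasure_mem_Ioo L] with x h hx
    rw [h]
    exact hf₂.nonneg ⟨hx.1.le, hx.2.le⟩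
  have hY₁ : 0 < primitive L L e₁ := by
    rw [primitive_eq_integral_of_ae hL he₁]; exact hf₁.integral_pos hL
  have hY₂ : 0 < primitive L L e₂ := by
    rw [primitive_eq_integral_of_ae hL he₂]; exact hf₂.integral_pos hL
  have hloop : ∀ (w : ℝ), 0 < w → ∀ p v, ClosedLoop lam1 lam2 L ps₁ ps₂ α₁ α₂ w p v ↔
      graphMap ps₀ (ps₀ + ∫ x in (0 : ℝ)..L, ps₁ x) (α₁ * w) (α₂ * w) e₁ e₂ (p, v) = 0 :=
    fun w hw p v => closedLoop_iff hps hL hlam1 hlam2 hα₁ hα₂ hw he₁ he₂ p v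
  obtain ⟨P, hPc, hP0, hPm, hPlim⟩ := exists_mild hL ha hα₁ hα₂ hf₁ hf₂ he₁ he₂ φ
  have hden : ps₀ + (∫ x in (0 : ℝ)..L, ps₁ x) + ∫ x in (0 : ℝ)..L, ps₂ x = 1 := by
    have := hps.total
    linarith
  rw [hden, totalMass_eq_stateNorm hL hφ₀ hφ₁ hφ₂, hφ, div_one, one_smul] at hPlim
  set A := ps₀ + ∫ x in (0 : ℝ)..L, ps₁ x
  have hsub : ∀ j t, t ∈ Icc (switchTime tf j) (switchTime tf (j + 1)) → t < tf := fun j t ht =>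
    ht.2.trans_lt (switchTime_lt htf _)
  have hjpos : ∀ j : ℕ, (0 : ℝ) < j + 1 := fun j => by positivity
  set p : ℝ → RepairState L := fun t => if t < tf then P (clock tf t) else (ps₀, e₁, e₂) with hp
  have hpt : ∀ t, t < tf → p t = P (clock tf t) := fun t ht => if_pos ht
  have hptf : p tf = (ps₀, e₁, e₂) := if_neg (lt_irrefl tf)
  have hcont : ContinuousOn p (Iio tf) :=
    (hPc.comp_continuousOn (continuousOn_clock htf)).congr fun t ht => hpt t ht
  have hint : ∀ j t, t ∈ Icc (switchTime tf j) (switchTime tf (j + 1)) →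
      ∫ s in (switchTime tf j)..t, p s =
        ((j : ℝ) + 1)⁻¹ • ∫ s in (clock tf (switchTime tf j))..(clock tf t), P s := by
    intro j t ht
    have h1 : ∫ s in (switchTime tf j)..t, p s = ∫ s in (switchTime tf j)..t,
        P ((clock tf (switchTime tf j) - (j + 1) * switchTime tf j) + (j + 1) * s) := by
      refine intervalIntegral.integral_congr fun s hs => ?_
      rw [uIcc_of_le ht.1] at hs
      have hs' : s ∈ Icc (switchTime tf j) (switchTime tf (j + 1)) := ⟨hs.1, hs.2.trans ht.2⟩
      rw [hpt s (hsub j s hs'), clock_eq_add htf hs']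
      congr 1
      ring
    rw [h1, intervalIntegral.integral_comp_add_mul _ (hjpos j).ne']
    congr 2
    · ring
    · rw [clock_eq_add htf ht]
      ring
  have hmild : ∀ j : ℕ, ∀ t ∈ Icc (switchTime tf j) (switchTime tf (j + 1)),
      graphMap ps₀ A (α₁ * (j + 1)) (α₂ * (j + 1)) e₁ e₂
        (∫ s in (switchTime tf j)..t, p s, p t - p (switchTime tf j)) = 0 := by
    intro j t ht
    have hP1 := graphMap_sub (hPm _ (clock_nonneg (tf := tf) t))
      (hPm _ (clock_nonneg (tf := tf) (switchTime tf j)))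
    rw [sub_sub_sub_cancel_right, intervalIntegral.integral_interval_sub_left
      (hPc.intervalIntegrable _ _) (hPc.intervalIntegrable _ _)] at hP1
    rw [hint j t ht, hpt t (hsub j t ht), hpt _ (switchTime_lt htf j)]
    exact graphMap_inv_smul hP1
  have hp0 : p 0 = φ := by rw [hpt 0 htf, clock_zero htf, hP0]
  refine ⟨p, ⟨hcont.mono fun t ht => ht.2, hp0, fun j t ht => ?_⟩, fun q hq t ht => ?_, ?_, ?_, ?_,
    ?_, ?_⟩
  · exact (hloop _ (hjpos j) _ _).2 (hmild j t ht)
  · have hq' : ∀ j : ℕ, q (switchTime tf j) = p (switchTime tf j) →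
        ∀ t ∈ Icc (switchTime tf j) (switchTime tf (j + 1)), q t = p t := fun j hj =>
      mild_unique hL hn₁ hn₂ hY₁ hY₂ (mul_pos hα₁ (hjpos j)) (mul_pos hα₂ (hjpos j))
        (switchTime_lt_succ htf j)
        (hq.continuousOn.mono fun t ht => ⟨(switchTime_nonneg htf j).trans ht.1, hsub j t ht⟩)
        (hcont.mono fun t ht => hsub j t ht) hj
        (fun t ht => (hloop _ (hjpos j) _ _).1 (hq.mild j t ht)) (hmild j)
    have hq'' : ∀ j : ℕ, q (switchTime tf j) = p (switchTime tf j) := fun j => by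
      induction j with
      | zero => rw [switchTime_zero, hq.initial, hp0]
      | succ j ih => exact hq' j ih _ (right_mem_Icc.2 (switchTime_lt_succ htf j).le)
    obtain ⟨j, hj⟩ := exists_mem_Ico_switchTime ht
    exact hq' j (hq'' j) t ⟨hj.1, hj.2.le⟩
  · rintro ⟨v, hv⟩ j t ht
    rw [hloop 1 one_pos, mul_one, mul_one] at hv
    obtain ⟨Q, hQc, hQ0, hQm, -⟩ := exists_mild hL ha hα₁ hα₂ hf₁ hf₂ he₁ he₂ v
    have key : ∀ s, 0 ≤ s → P s = P 0 + ∫ r in (0 : ℝ)..s, Q r ∧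
        graphMap ps₀ A α₁ α₂ e₁ e₂ (P s, Q s) = 0 := fun s hs =>
      mild_eq_add_integral hL hn₁ hn₂ hY₁ hY₂ hα₁ hα₂ hPc hQc hPm hQm
        (by rwa [hP0, hQ0]) hs
    have ht' : t ∈ Icc (switchTime tf j) (switchTime tf (j + 1)) := ⟨ht.1, ht.2.le⟩
    refine ⟨((j : ℝ) + 1) • Q (clock tf t), ?_, ?_⟩
    · rw [hloop _ (hjpos j), hpt t (hsub j t ht')]
      exact graphMap_smul_right (hjpos j).ne' (key _ (clock_nonneg t)).2
    · have hclock : HasDerivAt (fun s => clock tf (switchTime tf j) +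
          ((j : ℝ) + 1) * (s - switchTime tf j)) ((j : ℝ) + 1) t := by
        simpa using (((hasDerivAt_id t).sub_const (switchTime tf j)).const_mul
          ((j : ℝ) + 1)).const_add (clock tf (switchTime tf j))
      have hR : HasDerivAt (fun s => P 0 + ∫ r in (0 : ℝ)..s, Q r) (Q (clock tf t))
          (clock tf (switchTime tf j) + ((j : ℝ) + 1) * (t - switchTime tf j)) := by
        rw [← clock_eq_add htf ht']
        exact (hQc.integral_hasStrictDerivAt 0 _).hasDerivAt.const_add _
      refine (hR.scomp t hclock).hasDerivWithinAt.congr_of_mem (fun s hs => ?_) ht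
      have hs' : s ∈ Icc (switchTime tf j) (switchTime tf (j + 1)) := ⟨hs.1, hs.2.le⟩
      rw [hpt s (hsub j s hs'), (key _ (clock_nonneg s)).1, Function.comp,
        ← clock_eq_add htf hs']
  · intro t ht
    rcases ht.2.lt_or_eq with h | h
    · exact (hcont.continuousAt (Iio_mem_nhds h)).continuousWithinAt
    · rw [h]
      have h1 : ContinuousWithinAt p (Iio tf) tf := by
        rw [ContinuousWithinAt, hptf]
        refine (hPlim.comp (tendsto_clock htf)).congr' ?_
        filter_upwards [self_mem_nhdsWithin] with s hs
        exact (hpt s hs).symm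
      refine (continuousWithinAt_insert_self.2 h1).mono fun s hs => ?_
      rcases hs.2.lt_or_eq with h' | h'
      · exact Or.inr h'
      · exact Or.inl h'
  · rw [hptf]
  · rw [hptf]
    exact he₁
  · rw [hptf]
    exact he₂
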